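/- **Setting.** There are $k\ge 1$ desired labels $\mathcal Y=\{y_1,\dots,y_k\}$, one of which may be a special label "unknown", and $\hat k$ seen labels $\hat{\mathcal Y}=\{\hat y_1,\dots,\hat y_{\hat k}\}$, disjoint from $\mathcal Y$. Indirect labeling functions $\lambda_1,\dots,\lambda_n$ map a data point $X\in\mathcal X$ to labels in nonempty sets $\mathcal Y_1,\dots,\mathcal Y_n$ with union $\hat{\mathcal Y}$; put $\lambda=(\lambda_1,\dots,\lambda_n)$. A label graph assigns to each ordered pair of labels one of the relations exclusive ($e$), overlapping ($o$), subsuming ($sg$), subsumed ($sd$), with the converse relation for the reversed pair. Let $\mathcal Y'$ be $\mathcal Y$ without "unknown", $k'=|\mathcal Y'|$, and $\mathcal N(y,\mathcal Y_j)=\{\hat y\in\mathcal Y_j:\ y,\hat y \text{ not exclusive}\}$. For $Y\in\mathcal Y$, $\bar Y\in\{0,1\}^{\hat k}$, $\hat Y\in\prod_j\mathcal Y_j$, let $\Phi(Y,\bar Y,\hat Y)\in\mathbb R^M$ be the vector of all the following $M$ factors: $\mathbb 1\{Y=y,\hat Y^j=\hat y\}$ for $y\in\mathcal Y'$, $j\le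 n$, $\hat y\in\mathcal N(y,\mathcal Y_j)$; $\mathbb 1\{\bar Y^i=1,\hat Y^j=\hat y_i\}$ for $\hat y_i\in\mathcal Y_j$; and one relation factor for each pair $(\hat y_i,\hat y_j)$, $i<j$, and each pair $(y,\hat y_i)$ with $y\in\mathcal Y'$, namely $-\mathbb 1\{a=b=1\}$, $\mathbb 1\{a=b=1\}$, $-\mathbb 1\{a=0,b=1\}$, $-\mathbb 1\{a=1,b=0\}$ if the relation is $e$, $o$, $sg$, $sd$ respectively, where $(a,b)=(\bar Y^i,\bar Y^j)$, respectively $(a,b)=(\mathbb 1\{Y=y\},\bar Y^i)$. The model is $\pi_\Theta(Y,\bar Y,\hat Y)\propto\exp(\Theta^\top\Phi(Y,\bar Y,\hat Y))$, $\Theta\in\mathbb R^M$. Let $\mathcal F\subseteq\mathbb R^M$ be a closed convex set of feasible parameters (possibly $\mathcal F=\mathbb R^M$), let $\Theta^*,\Theta_0\in\mathcal F$ and $c>0$. The end model with parameter $w$ has logits $h(X,w)\in\mathbb R^{k}$. Let $\mathcal H(Y,\sigma(h))$ be the cross entropy of $Y$ and the softmax of $h$. For a problem distribution $\pi^*$ of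 $(X,Y)$ put $$\ell(w)=\mathbb E_{\pi^*}\,\mathcal H(Y,\sigma(h(X,w))),\qquad \ell_\Theta(w)=\mathbb E_{X\sim\pi^*}\,\mathbb E_{Y\sim\pi_\Theta(\cdot\mid\hat Y=\lambda(X))}\,\mathcal H(Y,\sigma(h(X,w))),$$ and $\ell(w^*)=\inf_w\ell(w)$. **Algorithm.** Let $D$ be a dataset of $|D|\ge 1$ i.i.d. data points from the $X$-marginal of $\pi^*$. Start at $\hat\Theta=\Theta_0$; for each $X\in D$ in turn sample independently $s\sim\pi_{\hat\Theta}$ and $s'\sim\pi_{\hat\Theta}(\cdot\mid\hat Y=\lambda(X))$, and replace $\hat\Theta$ by the point of $\mathcal F$ nearest to $\hat\Theta+\eta(\Phi(s')-\Phi(s))$. After one pass over $D$ let $\hat w$ be a minimizer of the empirical noise-aware loss $\frac1{|D|}\sum_{X\in D}\mathbb E_{Y\sim\pi_{\hat\Theta}(\cdot\mid\hat Y=\lambda(X))}\mathcal H(Y,\sigma(h(X,w)))$. **Assumptions.** 1. $\mathbb P_{\pi^*}(Y=y,\lambda(X)=o)=\pi_{\Theta^*}(Y=y,\hat Y=o)$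 for all $y,o$. 2. Under $\pi^*$, $Y$ is independent of $X$ given $\lambda(X)$. 3. For each $\Theta\in\mathcal F$ there is an estimator $T$, a function of $|D|$ i.i.d. samples of $\pi_\Theta$, that is unbiased at $\Theta$ to first order (the bias $\Theta'\mapsto\mathbb E_{\Theta'}T-\Theta'$ and its derivative vanish at $\Theta$) and has $\mathrm{Cov}_\Theta(T)\preceq\frac{I}{2c|D|}$. 4. For each $\Theta\in\mathcal F$, $$\mathbb E_{o\sim\pi_{\Theta^*}(\hat Y)}\Big[\sum_{y\in\mathcal Y'}(n_y+\hat k)\mathrm{Var}_{\pi_\Theta}(\mathbb 1_{Y=y}\mid\hat Y=o)^2+\sum_{i=1}^{\hat k}(m_i+\hat k+k'-1)\mathrm{Var}_{\pi_\Theta}(\bar Y^i\mid\hat Y=o)^2\Big]^{1/2}\le\frac{c}{\sqrt{2M}},$$ where $n_y$ is the number of $j$ with $\mathcal N(y,\mathcal Y_j)\ne\emptyset$ and $m_i$ the number of $j$ with $\hat y_i\in\mathcal Y_j$. 5. $\|h(X,w)\|_\infty\le H$ for all $X,w$. 6. $\mathbb E[\ell_{\hat\Theta}(\hat w)-\inf_w\ell_{\hat\Theta}(w)]\le\chi$.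 **Conclusion.** (a) If $\varepsilon>0$, $\eta=\frac{c\varepsilon^2}{4}$ and $|D|>\frac{2}{c^2\varepsilon^2}\log\frac{2\|\Theta_0-\Theta^*\|^2}{\varepsilon^2}$, then $$\mathbb E\|\hat\Theta-\Theta^*\|^2\le M\varepsilon^2,\qquad \mathbb E[\ell(\hat w)-\ell(w^*)]\le\chi+4cH\varepsilon.$$ (b) The rates $O(M\log|D|/|D|)$ and $\chi+O(H\sqrt{\log|D|/|D|})$ are attained: if $|D|\ge2$ and $\eta=\frac{\log|D|}{c|D|}$, then $$\mathbb E\|\hat\Theta-\Theta^*\|^2\le\frac4{c^2}\,M\,\frac{\log|D|}{|D|},\qquad \mathbb E[\ell(\hat w)-\ell(w^*)]\le\chi+8H\sqrt{\frac{\log|D|}{|D|}}.$$ (If $\Theta_0=\Theta^*$ in (a), the condition on $|D|$ is void.) -/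

import Mathlib

open MeasureTheory ProbabilityTheory
open scoped BigOperators ENNReal

noncomputable section

/-- The four types of relation between two labels, each label being thought of as a set. -/
inductive LabelRel where
  | exclusive
  | overlapping
  | subsuming
  | subsumed
  deriving DecidableEq

/-- The relation seen from the other side. -/
def LabelRel.converse : LabelRel → LabelRel
  | .exclusive => .exclusive
  | .overlapping => .overlapping
  | .subsuming => .subsumed
  | .subsumed => .subsuming

/-- A specification of weak indirect supervision: `k` desired labels `Fin k`, `khat` seen labels
`Fin khat` (disjoint from the desired ones), and `n` indirect labeling functions, the `j`-th of
which outputs labels in the nonempty set `space j` of seen labels; the seen labels are exactly the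
labels that some labeling function can output. `rel` is the label graph on all labels.
`unknown` is the desired label (if there is one) that stands for "unknown" and has no factors. -/
structure WIS (k khat n : ℕ) where
  space : Fin n → Finset (Fin khat)
  space_nonempty : ∀ j, (space j).Nonempty
  space_cover : ∀ i, ∃ j, i ∈ space j
  rel : Fin k ⊕ Fin khat → Fin k ⊕ Fin khat → LabelRel
  rel_converse : ∀ a b, a ≠ b → rel b a = (rel a b).converse
  unknown : Option (Fin k)

namespace WIS

variable {k khat n : ℕ} (G : WIS k khat n)

/-- The desired labels other than "unknown". -/
abbrev Known : Type := {y : Fin k // G.unknown ≠ some y}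

/-- Type of the concatenated outputs `Ŷ = (Ŷ¹, …, Ŷⁿ)` of the labeling functions. -/
abbrev Out : Type := (j : Fin n) → {i : Fin khat // i ∈ G.space j}

/-- The joint values `(Y, Ȳ, Ŷ)` of the model. -/
abbrev State : Type := Fin k × (Fin khat → Bool) × G.Out

/-- The set `N(y, 𝒴_j)` of labels of the `j`-th labeling function not exclusive to `y`. -/
def nonExcl (y : Fin k) (j : Fin n) : Finset (Fin khat) :=
  (G.space j).filter fun i => G.rel (Sum.inl y) (Sum.inr i) ≠ LabelRel.exclusive

/-- The factors of the model, in this order: pseudo accuracy `(y, j, ŷ)` with `ŷ ∈ N(y, 𝒴_j)`;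
accuracy `(j, ŷ)` with `ŷ ∈ 𝒴_j`; relation between two seen labels `i < j`; relation between a
desired and a seen label. -/
abbrev Factor : Type :=
  {p : G.Known × Fin n × Fin khat // p.2.2 ∈ G.nonExcl p.1 p.2.1} ⊕
  {p : Fin n × Fin khat // p.2 ∈ G.space p.1} ⊕
  {p : Fin khat × Fin khat // p.1 < p.2} ⊕
  (G.Known × Fin khat)

/-- The parameter space `ℝ^M`. -/
abbrev Param : Type := EuclideanSpace ℝ G.Factor

/-- The number `M` of factors. -/
def numFactors : ℕ := Fintype.card G.Factor

/-- Factor of a label pair with relation `r`, in terms of "the data has the first label" and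
"the data has the second label". -/
def relFactor (r : LabelRel) (a b : Bool) : ℝ :=
  match r with
  | .exclusive => if a = true ∧ b = true then -1 else 0
  | .overlapping => if a = true ∧ b = true then 1 else 0
  | .subsuming => if a = false ∧ b = true then -1 else 0
  | .subsumed => if a = true ∧ b = false then -1 else 0

/-- The factor functions. -/
def factor : G.Factor → G.State → ℝ
  | .inl p, s => if s.1 = p.1.1.1 ∧ (s.2.2 p.1.2.1).1 = p.1.2.2 then 1 else 0
  | .inr (.inl p), s => if s.2.1 p.1.2 = true ∧ (s.2.2 p.1.1).1 = p.1.2 then 1 else 0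
  | .inr (.inr (.inl p)), s =>
      relFactor (G.rel (Sum.inr p.1.1) (Sum.inr p.1.2)) (s.2.1 p.1.1) (s.2.1 p.1.2)
  | .inr (.inr (.inr p)), s =>
      relFactor (G.rel (Sum.inl p.1.1) (Sum.inr p.2)) (decide (s.1 = p.1.1)) (s.2.1 p.2)

/-- The vector `Φ(Y, Ȳ, Ŷ)` of all factors. -/
def feat (s : G.State) : G.Param := WithLp.toLp 2 fun f => G.factor f s

/-- The unnormalized weight `exp (Θᵀ Φ)`. -/
def weight (Θ : G.Param) (s : G.State) : ℝ := Real.exp (∑ f, Θ f * G.factor f s)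

/-- The model `π_Θ(Y, Ȳ, Ŷ) ∝ exp (Θᵀ Φ(Y, Ȳ, Ŷ))`. -/
def prob (Θ : G.Param) (s : G.State) : ℝ := G.weight Θ s / ∑ s', G.weight Θ s'

/-- The conditional law `π_Θ(Y, Ȳ, Ŷ | Ŷ = o)`. -/
def condProb (Θ : G.Param) (o : G.Out) (s : G.State) : ℝ :=
  if s.2.2 = o then G.weight Θ s / ∑ s', (if s'.2.2 = o then G.weight Θ s' else 0) else 0

/-- The marginal law `π_Θ(Ŷ = o)`. -/
def outProb (Θ : G.Param) (o : G.Out) : ℝ := ∑ s, if s.2.2 = o then G.prob Θ s else 0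

/-- The marginal law `π_Θ(Y = y, Ŷ = o)`. -/
def labelOutProb (Θ : G.Param) (y : Fin k) (o : G.Out) : ℝ :=
  ∑ s, if s.1 = y ∧ s.2.2 = o then G.prob Θ s else 0

/-- The probabilistic label `π_Θ(Y = y | Ŷ = o)`. -/
def posterior (Θ : G.Param) (o : G.Out) (y : Fin k) : ℝ :=
  ∑ s, if s.1 = y then G.condProb Θ o s else 0

/-- The conditional variance `Var_{π_Θ}(g | Ŷ = o)`. -/
def condVar (Θ : G.Param) (o : G.Out) (g : G.State → ℝ) : ℝ :=
  ∑ s, G.condProb Θ o s * (g s - ∑ s', G.condProb Θ o s' * g s') ^ 2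

/-! ### Stochastic gradient ascent on the marginal log-likelihood -/

theorem weight_pos (Θ : G.Param) (s : G.State) : 0 < G.weight Θ s := Real.exp_pos _

instance [NeZero k] : Nonempty G.State :=
  ⟨(0, fun _ => true, fun j => ⟨(G.space_nonempty j).choose, (G.space_nonempty j).choose_spec⟩)⟩

theorem sum_weight_pos [NeZero k] (Θ : G.Param) : 0 < ∑ s, G.weight Θ s :=
  Finset.sum_pos (fun s _ => G.weight_pos Θ s) Finset.univ_nonempty

theorem sum_weight_out_pos [NeZero k] (Θ : G.Param) (o : G.Out) :
    0 < ∑ s : G.State, (if s.2.2 = o then G.weight Θ s else 0) := by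
  refine Finset.sum_pos' (fun s _ => ?_) ⟨((0 : Fin k), fun _ => true, o), Finset.mem_univ _, ?_⟩
  · split_ifs
    · exact (G.weight_pos Θ s).le
    · exact le_rfl
  · simpa using G.weight_pos Θ _

theorem prob_nonneg [NeZero k] (Θ : G.Param) (s : G.State) : 0 ≤ G.prob Θ s :=
  div_nonneg (G.weight_pos Θ s).le (G.sum_weight_pos Θ).le

theorem sum_prob [NeZero k] (Θ : G.Param) : ∑ s, G.prob Θ s = 1 := by
  simp only [prob]
  rw [← Finset.sum_div, div_self (G.sum_weight_pos Θ).ne']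

theorem condProb_nonneg [NeZero k] (Θ : G.Param) (o : G.Out) (s : G.State) :
    0 ≤ G.condProb Θ o s := by
  unfold condProb
  split_ifs
  · exact div_nonneg (G.weight_pos Θ s).le (G.sum_weight_out_pos Θ o).le
  · exact le_rfl

theorem sum_condProb [NeZero k] (Θ : G.Param) (o : G.Out) : ∑ s, G.condProb Θ o s = 1 := by
  have h : ∀ s : G.State, G.condProb Θ o s = (if s.2.2 = o then G.weight Θ s else 0) /
      ∑ s' : G.State, (if s'.2.2 = o then G.weight Θ s' else 0) := by
    intro s
    unfold condProb
    split_ifs <;> simp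
  simp only [h]
  rw [← Finset.sum_div, div_self (G.sum_weight_out_pos Θ o).ne']

/-- `π_Θ` as a law to sample from. -/
def probPMF [NeZero k] (Θ : G.Param) : PMF G.State :=
  PMF.ofFintype (fun s => ENNReal.ofReal (G.prob Θ s)) (by
    rw [← ENNReal.ofReal_sum_of_nonneg fun s _ => G.prob_nonneg Θ s, G.sum_prob,
      ENNReal.ofReal_one])

/-- `π_Θ(· | Ŷ = o)` as a law to sample from. -/
def condPMF [NeZero k] (Θ : G.Param) (o : G.Out) : PMF G.State :=
  PMF.ofFintype (fun s => ENNReal.ofReal (G.condProb Θ o s)) (by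
    rw [← ENNReal.ofReal_sum_of_nonneg fun s _ => G.condProb_nonneg Θ o s, G.sum_condProb,
      ENNReal.ofReal_one])

open Classical in
/-- A nearest point of `F` to `Θ` (unique if `F` is nonempty, closed and convex; `Θ` itself if
`F` is the whole space). -/
def proj (F : Set G.Param) (Θ : G.Param) : G.Param :=
  if h : ∃ v ∈ F, ∀ u ∈ F, ‖Θ - v‖ ≤ ‖Θ - u‖ then h.choose else Θ

/-- One step of stochastic gradient ascent at a data point with labeling-function output `o`:
sample `s ∼ π_Θ` and, independently, `s' ∼ π_Θ(· | Ŷ = o)`, and move `Θ` to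
`Θ + η (Φ(s') - Φ(s))`, projected to the feasible set `F`. -/
def sgdStep [NeZero k] (F : Set G.Param) (η : ℝ) (o : G.Out) (Θ : G.Param) : PMF G.Param :=
  (G.probPMF Θ).bind fun s => (G.condPMF Θ o).bind fun s' =>
    PMF.pure (G.proj F (Θ + η • (G.feat s' - G.feat s)))

/-- The law of the parameter after one pass over the data, starting from `Θ`. -/
def sgd [NeZero k] (F : Set G.Param) (η : ℝ) : List G.Out → G.Param → PMF G.Param
  | [], Θ => PMF.pure Θ
  | o :: L, Θ => (G.sgdStep F η o Θ).bind fun Θ' => sgd F η L Θ'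

/-! ### The end model and its risks -/

/-- Cross entropy of the label `y` and the softmax of the logits `v`. -/
def crossEntropy (v : Fin k → ℝ) (y : Fin k) : ℝ :=
  -Real.log (Real.exp (v y) / ∑ l, Real.exp (v l))

variable {X W Ω : Type*}

/-- The labeling functions, applied together. -/
def outputs (lam : (j : Fin n) → X → {i : Fin khat // i ∈ G.space j}) (x : X) : G.Out :=
  fun j => lam j x

/-- The noise-aware loss at a point: the expectation of the cross entropy under the probabilistic
label. -/
def noisyLoss (lam : (j : Fin n) → X → {i : Fin khat // i ∈ G.space j})
    (h : W → X → Fin k → ℝ) (Θ : G.Param) (w : W) (x : X) : ℝ :=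
  ∑ y, G.posterior Θ (G.outputs lam x) y * crossEntropy (h w x) y

/-- The empirical noise-aware loss over a dataset. -/
def empiricalLoss (lam : (j : Fin n) → X → {i : Fin khat // i ∈ G.space j})
    (h : W → X → Fin k → ℝ) {m : ℕ} (x : Fin m → X) (Θ : G.Param) (w : W) : ℝ :=
  (1 / (m : ℝ)) * ∑ t, G.noisyLoss lam h Θ w (x t)

/-- The expected risk `ℓ(w)` of the end model under the problem distribution. -/
def risk [MeasurableSpace X] (π : Measure (X × Fin k)) (h : W → X → Fin k → ℝ) (w : W) : ℝ :=
  ∫ p, crossEntropy (h w p.1) p.2 ∂π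

/-- The expected noise-aware risk `ℓ_Θ(w)`. -/
def noisyRisk [MeasurableSpace X] (π : Measure (X × Fin k))
    (lam : (j : Fin n) → X → {i : Fin khat // i ∈ G.space j})
    (h : W → X → Fin k → ℝ) (Θ : G.Param) (w : W) : ℝ :=
  ∫ p, G.noisyLoss lam h Θ w p.1 ∂π

/-! ### The assumptions -/

/-- The problem distribution agrees with `π_Θ` on `(Y, Ŷ)`. -/
def WellSpecified [MeasurableSpace X] (π : Measure (X × Fin k))
    (lam : (j : Fin n) → X → {i : Fin khat // i ∈ G.space j}) (Θ : G.Param) : Prop :=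
  ∀ y o, π.real {p | p.2 = y ∧ G.outputs lam p.1 = o} = G.labelOutProb Θ y o

/-- `Y` is independent of `X` given the (finitely valued) outputs of the labeling functions. -/
def LabelCondIndep [MeasurableSpace X] (π : Measure (X × Fin k))
    (lam : (j : Fin n) → X → {i : Fin khat // i ∈ G.space j}) : Prop :=
  ∀ o, IndepFun Prod.snd Prod.fst (ProbabilityTheory.cond π {p | G.outputs lam p.1 = o})

/-- The probability of a dataset of `m` independent samples of `π_Θ`. -/
def sampleProb {m : ℕ} (Θ : G.Param) (d : Fin m → G.State) : ℝ := ∏ t, G.prob Θ (d t)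

/-- The expectation of an estimator under `m` independent samples of `π_Θ`. -/
def estMean {m : ℕ} (T : (Fin m → G.State) → G.Param) (Θ : G.Param) : G.Param :=
  ∑ d, G.sampleProb Θ d • T d

/-- `T` is unbiased at `Θ` to first order: its bias vanishes at `Θ` together with its derivative.
Every estimator that is unbiased in a neighbourhood of `Θ` has this property. -/
def UnbiasedAt {m : ℕ} (T : (Fin m → G.State) → G.Param) (Θ : G.Param) : Prop :=
  G.estMean T Θ = Θ ∧ HasFDerivAt (G.estMean T) (ContinuousLinearMap.id ℝ G.Param) Θ

/-- The covariance matrix of `T` under `π_Θ` is at most `b` times the identity. -/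
def CovLE {m : ℕ} (T : (Fin m → G.State) → G.Param) (Θ : G.Param) (b : ℝ) : Prop :=
  ∀ u : G.Param,
    ∑ d, G.sampleProb Θ d * (inner ℝ u (T d - G.estMean T Θ)) ^ 2 ≤ b * ‖u‖ ^ 2

/-- At each feasible parameter there is an unbiased estimator from `m` samples of the full model
with covariance at most `I / (2 c m)`. -/
def EfficientEstimator (F : Set G.Param) (c : ℝ) (m : ℕ) : Prop :=
  ∀ Θ ∈ F, ∃ T : (Fin m → G.State) → G.Param, G.UnbiasedAt T Θ ∧ G.CovLE T Θ (1 / (2 * c * m))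

/-- The number of labeling functions with some label that is not exclusive to `y`. -/
def numNonExcl (y : Fin k) : ℕ := (Finset.univ.filter fun j => (G.nonExcl y j).Nonempty).card

/-- The number of labeling functions whose label space contains the seen label `i`. -/
def numCover (i : Fin khat) : ℕ := (Finset.univ.filter fun j => i ∈ G.space j).card

/-- The weighted sum of squared posterior variances of the latent variables given `Ŷ = o`. -/
def posteriorSpread (Θ : G.Param) (o : G.Out) : ℝ :=
  (∑ y : G.Known, ((G.numNonExcl y : ℝ) + khat) *
      G.condVar Θ o (fun s => if s.1 = y.1 then 1 else 0) ^ 2) +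
    ∑ i : Fin khat, ((G.numCover i : ℝ) + ((khat : ℝ) + Fintype.card G.Known) - 1) *
      G.condVar Θ o (fun s => if s.2.1 i = true then 1 else 0) ^ 2

/-- The latent variables are guessed with reasonable certainty at every feasible parameter. -/
def LowPosteriorVariance (F : Set G.Param) (Θstar : G.Param) (c : ℝ) : Prop :=
  ∀ Θ ∈ F, ∑ o, G.outProb Θstar o * Real.sqrt (G.posteriorSpread Θ o) ≤
    c / Real.sqrt (2 * G.numFactors)

/-- `(D, Θhat, what)` is a run of the learning algorithm: `D` is a dataset of `m` independent data
points; given `D`, the parameter `Θhat` has the law of one pass of stochastic gradient ascent over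
`D` started at `Θ₀`; and `what` minimizes the empirical noise-aware loss with parameter `Θhat`. -/
structure IsRun [NeZero k] [MeasurableSpace X] [MeasurableSpace W] [MeasurableSpace Ω]
    (π : Measure (X × Fin k)) (lam : (j : Fin n) → X → {i : Fin khat // i ∈ G.space j})
    (h : W → X → Fin k → ℝ) (F : Set G.Param) (Θ₀ : G.Param) (η : ℝ) {m : ℕ}
    (P : Measure Ω) (D : Ω → Fin m → X) (Θhat : Ω → G.Param) (what : Ω → W) : Prop where
  measurable_D : Measurable D
  measurable_Θhat : Measurable Θhat
  measurable_what : Measurable what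
  law : ∀ (A : Set (Fin m → X)) (B : Set G.Param), MeasurableSet A → MeasurableSet B →
    P (D ⁻¹' A ∩ Θhat ⁻¹' B) =
      ∫⁻ x in A, (G.sgd F η (List.ofFn fun t => G.outputs lam (x t)) Θ₀).toMeasure B
        ∂(Measure.pi fun _ => π.map Prod.fst)
  argmin : ∀ᵐ ω ∂P, ∀ w,
    G.empiricalLoss lam h (D ω) (Θhat ω) (what ω) ≤ G.empiricalLoss lam h (D ω) (Θhat ω) w

end WIS

end

/-! The model is an exponential family, so along a line in parameter space the derivative of any
mean is a covariance with the directional statistic `linFeat`. This holds for the joint law, for the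
law given the outputs, and for i.i.d. samples (`hasDerivAt_wmean_gibbs`).

The expected marginal log-likelihood has as its gradient the averaged posterior mean of `Φ` minus
its model mean. This vanishes at `Θstar` by the tower property, and its derivative is the averaged
posterior covariance minus the full covariance. The information inequality
`EfficientEstimator.le_wcov` bounds the full covariance below by `2c`. The variance assumption
bounds the averaged posterior covariance above by `c` (`sum_outProb_mul_wcov_le`). The objective is
therefore `c`-strongly concave on `F`, in the form `drift_le`.

A projected step does not increase the distance to `Θstar`, and two values of `Φ` differ by at most
`√M` in norm. Hence one step contracts the mean squared distance by `1 - 2ηc` up to an error `η² M`,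
and iteration gives `passMean_dist_sq_le`. The same drift bound, set against gradients of length at
most `√M`, confines `F` to the ball of radius `√M / c` about `Θstar` (`dist_sq_le_of_mem`). This
settles step sizes too large for the contraction argument.

For the end model, every factor has increments `0` or `±1`, so its posterior covariance with a
bounded function is at most twice its variance. Posteriors are thus Lipschitz on average with
constant `2c/√M` (`sum_outProb_mul_posterior_sub_le`). In the difference of `ℓ_Θ` and `ℓ` the
log-partition part of the cross entropy cancels and only logits bounded by `H` remain
(`abs_noisyRisk_sub_risk_le`). Comparing both the value and the infimum doubles the constant to
`4cH/√M`, and the `√M` cancels against the parameter error `√M ε`. -/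

noncomputable section

/-! ### Finite weighted means and covariances -/

section FiniteMean

variable {S : Type*} [Fintype S]

/-- The mean of `f` under the weights `p`. -/
def wmean (p f : S → ℝ) : ℝ := ∑ s, p s * f s

/-- The covariance of `f` and `g` under the weights `p`, in its symmetrized form. -/
def wcov (p f g : S → ℝ) : ℝ := 1 / 2 * ∑ s, ∑ s', p s * p s' * ((f s - f s') * (g s - g s'))

/-- Normalized weights. -/
def gibbs (w : S → ℝ) (s : S) : ℝ := w s / ∑ s', w s'

theorem sum_gibbs {w : S → ℝ} (hw : ∑ s, w s ≠ 0) : ∑ s, gibbs w s = 1 := by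
  simp only [gibbs]
  rw [← Finset.sum_div, div_self hw]

/-- Expansion of the product over pairs of states. The symmetrized form is kept as the definition
because variances can then be compared through increments, pair by pair. -/
theorem wcov_eq {p : S → ℝ} (hp : ∑ s, p s = 1) (f g : S → ℝ) :
    wcov p f g = wmean p (fun s => f s * g s) - wmean p f * wmean p g := by
  have h : ∀ s, ∑ s', p s * p s' * ((f s - f s') * (g s - g s')) =
      p s * (f s * g s) * ∑ s', p s' - p s * f s * ∑ s', p s' * g s'
        - p s * g s * ∑ s', p s' * f s' + p s * ∑ s', p s' * (f s' * g s') := by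
    intro s
    simp only [Finset.mul_sum, ← Finset.sum_sub_distrib, ← Finset.sum_add_distrib]
    exact Finset.sum_congr rfl fun s' _ => by ring
  simp only [wcov, wmean, h]
  simp only [Finset.sum_add_distrib, Finset.sum_sub_distrib, ← Finset.sum_mul, hp]
  ring

theorem wcov_self_eq_sum_sq {p : S → ℝ} (hp : ∑ s, p s = 1) (f : S → ℝ) :
    wcov p f f = ∑ s, p s * (f s - wmean p f) ^ 2 := by
  have h : ∑ s, p s * (f s - wmean p f) ^ 2 =
      ∑ s, p s * (f s * f s) - 2 * wmean p f * ∑ s, p s * f s + wmean p f ^ 2 * ∑ s, p s := by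
    simp only [Finset.mul_sum, ← Finset.sum_sub_distrib, ← Finset.sum_add_distrib]
    exact Finset.sum_congr rfl fun s' _ => by ring
  rw [h, hp, wcov_eq hp]
  simp only [wmean]
  ring

theorem wcov_self_nonneg {p : S → ℝ} (hp : ∀ s, 0 ≤ p s) (f : S → ℝ) : 0 ≤ wcov p f f := by
  unfold wcov
  refine mul_nonneg (by norm_num) (Finset.sum_nonneg fun s _ => Finset.sum_nonneg fun s' _ => ?_)
  exact mul_nonneg (mul_nonneg (hp s) (hp s')) (mul_self_nonneg _)

theorem wcov_sum_right {ι : Type*} [Fintype ι] (p f : S → ℝ) (v : ι → ℝ) (g : ι → S → ℝ) :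
    wcov p f (fun s => ∑ i, v i * g i s) = ∑ i, v i * wcov p f (g i) := by
  simp only [wcov, Finset.mul_sum, ← Finset.sum_sub_distrib]
  rw [Finset.sum_comm (s := (Finset.univ : Finset ι))]
  refine Finset.sum_congr rfl fun s _ => ?_
  rw [Finset.sum_comm (s := (Finset.univ : Finset ι))]
  exact Finset.sum_congr rfl fun _ _ => Finset.sum_congr rfl fun _ _ => by ring

/-- The variance is at most the sum of two variances if the squared increments are. -/
theorem wcov_self_le_add {p : S → ℝ} (hp : ∀ s, 0 ≤ p s) {f g h : S → ℝ}
    (hfg : ∀ s s', p s ≠ 0 → p s' ≠ 0 →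
      (f s - f s') ^ 2 ≤ (g s - g s') ^ 2 + (h s - h s') ^ 2) :
    wcov p f f ≤ wcov p g g + wcov p h h := by
  simp only [wcov, ← mul_add, ← Finset.sum_add_distrib]
  refine mul_le_mul_of_nonneg_left (Finset.sum_le_sum fun s _ => Finset.sum_le_sum fun s' _ => ?_)
    (by norm_num)
  by_cases h1 : p s = 0
  · simp [h1]
  by_cases h2 : p s' = 0
  · simp [h2]
  refine mul_le_mul_of_nonneg_left ?_ (mul_nonneg (hp s) (hp s'))
  have := hfg s s' h1 h2
  nlinarith

theorem wcov_self_le {p : S → ℝ} (hp : ∀ s, 0 ≤ p s) {f g : S → ℝ}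
    (hfg : ∀ s s', p s ≠ 0 → p s' ≠ 0 → (f s - f s') ^ 2 ≤ (g s - g s') ^ 2) :
    wcov p f f ≤ wcov p g g := by
  have h := wcov_self_le_add (h := fun _ => 0) hp (fun s s' h1 h2 => by
    simpa using hfg s s' h1 h2)
  simpa [wcov] using h

/-- The covariance of a `[-1, 1]`-valued function with a function whose increments are `0` or
`±1`. -/
theorem abs_wcov_le_two_mul {p : S → ℝ} (hp : ∀ s, 0 ≤ p s) {a f : S → ℝ}
    (ha : ∀ s, |a s| ≤ 1) (hf : ∀ s s', |f s - f s'| ≤ (f s - f s') ^ 2) :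
    |wcov p a f| ≤ 2 * wcov p f f := by
  have h : |wcov p a f| ≤
      1 / 2 * ∑ s, ∑ s', p s * p s' * (2 * ((f s - f s') * (f s - f s'))) := by
    rw [wcov, abs_mul, abs_of_pos (by norm_num : (0 : ℝ) < 1 / 2)]
    refine mul_le_mul_of_nonneg_left ?_ (by norm_num)
    refine (Finset.abs_sum_le_sum_abs _ _).trans (Finset.sum_le_sum fun s _ => ?_)
    refine (Finset.abs_sum_le_sum_abs _ _).trans (Finset.sum_le_sum fun s' _ => ?_)
    rw [abs_mul, abs_of_nonneg (mul_nonneg (hp s) (hp s')), abs_mul]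
    refine mul_le_mul_of_nonneg_left ?_ (mul_nonneg (hp s) (hp s'))
    have h1 : |a s - a s'| ≤ 2 := (abs_sub _ _).trans (by linarith [ha s, ha s'])
    have h2 := hf s s'
    calc |a s - a s'| * |f s - f s'| ≤ 2 * (f s - f s') ^ 2 :=
          mul_le_mul h1 h2 (abs_nonneg _) (by norm_num)
      _ = _ := by ring
  refine h.trans (le_of_eq ?_)
  simp only [wcov, Finset.mul_sum]
  exact Finset.sum_congr rfl fun _ _ => Finset.sum_congr rfl fun _ _ => by ring

/-- Cauchy–Schwarz over pairs of states, with each weight `p s * p s'` split into two square roots.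
-/
theorem wcov_sq_le {p : S → ℝ} (hp : ∀ s, 0 ≤ p s) (f g : S → ℝ) :
    wcov p f g ^ 2 ≤ wcov p f f * wcov p g g := by
  have h := Finset.sum_mul_sq_le_sq_mul_sq (Finset.univ : Finset (S × S))
    (fun q => √(p q.1 * p q.2) * (f q.1 - f q.2)) (fun q => √(p q.1 * p q.2) * (g q.1 - g q.2))
  have hq : ∀ q : S × S, √(p q.1 * p q.2) * √(p q.1 * p q.2) = p q.1 * p q.2 := fun q =>
    Real.mul_self_sqrt (mul_nonneg (hp _) (hp _))
  have e : ∀ f g : S → ℝ, 2 * wcov p f g = ∑ q : S × S,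
      √(p q.1 * p q.2) * (f q.1 - f q.2) * (√(p q.1 * p q.2) * (g q.1 - g q.2)) := by
    intro f g
    rw [Fintype.sum_prod_type, wcov, ← mul_assoc]
    norm_num only [one_mul]
    refine Finset.sum_congr rfl fun s _ => Finset.sum_congr rfl fun s' _ => ?_
    linear_combination -((f s - f s') * (g s - g s')) * hq (s, s')
  have e2 : ∀ f : S → ℝ, 2 * wcov p f f = ∑ q : S × S,
      (√(p q.1 * p q.2) * (f q.1 - f q.2)) ^ 2 := by
    intro f
    rw [e]
    exact Finset.sum_congr rfl fun _ _ => (sq _).symm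
  rw [← e, ← e2, ← e2] at h
  linarith

/-- The variance of a linear combination is at most the sum of the variances times the squared
length of the vector of coefficients. -/
theorem wcov_sum_self_le {ι : Type*} [Fintype ι] {p : S → ℝ} (hp : ∀ s, 0 ≤ p s)
    (v : ι → ℝ) (g : ι → S → ℝ) :
    wcov p (fun s => ∑ i, v i * g i s) (fun s => ∑ i, v i * g i s) ≤
      (∑ i, v i ^ 2) * ∑ i, wcov p (g i) (g i) := by
  have e : (∑ i, v i ^ 2) * ∑ i, wcov p (g i) (g i) = 1 / 2 * ∑ s, ∑ s', p s * p s' *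
      ((∑ i, v i ^ 2) * ∑ i, (g i s - g i s') ^ 2) := by
    simp only [wcov, ← Finset.mul_sum]
    rw [Finset.sum_comm, mul_left_comm]
    congr 1
    simp only [Finset.mul_sum]
    refine Finset.sum_congr rfl fun s _ => ?_
    rw [Finset.sum_comm]
    refine Finset.sum_congr rfl fun s' _ => Finset.sum_congr rfl fun i _ => ?_
    ring
  rw [e, wcov]
  refine mul_le_mul_of_nonneg_left (Finset.sum_le_sum fun s _ => Finset.sum_le_sum fun s' _ => ?_)
    (by norm_num)
  refine mul_le_mul_of_nonneg_left ?_ (mul_nonneg (hp s) (hp s'))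
  -- For a fixed pair of states, Cauchy–Schwarz over the index `i`.
  rw [← sq, ← Finset.sum_sub_distrib]
  simp only [← mul_sub]
  exact Finset.sum_mul_sq_le_sq_mul_sq _ _ _

/-- The derivative of a mean in an exponential family is a covariance. -/
theorem hasDerivAt_wmean_gibbs (w f g : S → ℝ) (t : ℝ)
    (hZ : ∑ s, w s * Real.exp (t * g s) ≠ 0) :
    HasDerivAt (fun τ : ℝ => wmean (gibbs fun s => w s * Real.exp (τ * g s)) f)
      (wcov (gibbs fun s => w s * Real.exp (t * g s)) f g) t := by
  have he : ∀ s, HasDerivAt (fun τ : ℝ => w s * Real.exp (τ * g s))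
      (w s * (Real.exp (t * g s) * g s)) t := fun s => by
    have := (((hasDerivAt_id t).mul_const (g s)).exp).const_mul (w s)
    simpa using this
  have hN : HasDerivAt (fun τ : ℝ => ∑ s, w s * Real.exp (τ * g s) * f s)
      (∑ s, w s * (Real.exp (t * g s) * g s) * f s) t :=
    HasDerivAt.fun_sum fun s _ => (he s).mul_const (f s)
  have hD : HasDerivAt (fun τ : ℝ => ∑ s, w s * Real.exp (τ * g s))
      (∑ s, w s * (Real.exp (t * g s) * g s)) t := HasDerivAt.fun_sum fun s _ => he s
  have h := hN.fun_div hD hZ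
  have hm : ∀ (τ : ℝ) (f : S → ℝ), wmean (gibbs fun s => w s * Real.exp (τ * g s)) f =
      (∑ s, w s * Real.exp (τ * g s) * f s) / ∑ s, w s * Real.exp (τ * g s) := by
    intro τ f
    simp only [wmean, gibbs, Finset.sum_div]
    exact Finset.sum_congr rfl fun s _ => by ring
  rw [wcov_eq (sum_gibbs hZ)]
  simp only [hm]
  refine h.congr_deriv ?_
  have e1 : ∑ s, w s * (Real.exp (t * g s) * g s) * f s =
      ∑ s, w s * Real.exp (t * g s) * (f s * g s) :=
    Finset.sum_congr rfl fun s _ => by ring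
  have e2 : ∑ s, w s * (Real.exp (t * g s) * g s) = ∑ s, w s * Real.exp (t * g s) * g s :=
    Finset.sum_congr rfl fun s _ => by ring
  rw [e1, e2]
  field_simp

/-- The sum over independent samples has `m` times the mean. -/
theorem sum_prod_mul_sum {p : S → ℝ} (hp : ∑ s, p s = 1) (g : S → ℝ) (m : ℕ) :
    ∑ d : Fin m → S, (∏ t, p (d t)) * ∑ t, g (d t) = m * ∑ s, p s * g s := by
  induction m with
  | zero => simp
  | succ m ih =>
    have h1 : ∑ d : Fin m → S, ∏ t, p (d t) = 1 := by
      rw [← Fintype.sum_pow, hp, one_pow]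
    rw [← (Fin.consEquiv fun _ => S).sum_comp, Fintype.sum_prod_type]
    simp only [Fin.consEquiv, Equiv.coe_fn_mk, Fin.prod_univ_succ, Fin.sum_univ_succ,
      Fin.cons_zero, Fin.cons_succ]
    have h2 : ∀ s, ∑ d : Fin m → S, p s * (∏ t, p (d t)) * (g s + ∑ t, g (d t)) =
        p s * g s * ∑ d : Fin m → S, ∏ t, p (d t) +
          p s * ∑ d : Fin m → S, (∏ t, p (d t)) * ∑ t, g (d t) := by
      intro s
      simp only [Finset.mul_sum, ← Finset.sum_add_distrib]
      refine Finset.sum_congr rfl fun d _ => ?_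
      rw [mul_add, Finset.mul_sum]
      congr 1
      · ring
      · exact Finset.sum_congr rfl fun _ _ => by ring
    simp only [h2, Finset.sum_add_distrib, ← Finset.sum_mul, h1, ih, hp]
    push_cast
    ring

end FiniteMean

namespace WIS

variable {k khat n : ℕ} (G : WIS k khat n)

/-! ### The model as an exponential family -/

/-- The weights restricted to the states with outputs `o`. -/
def outWeight (Θ : G.Param) (o : G.Out) (s : G.State) : ℝ := if s.2.2 = o then G.weight Θ s else 0

/-- Conditioning on the outputs only sets some base weights to zero, so the derivative formula for
Gibbs means applies unchanged. -/
theorem condProb_eq_gibbs (Θ : G.Param) (o : G.Out) : G.condProb Θ o = gibbs (G.outWeight Θ o) := by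
  funext s
  simp only [condProb, gibbs, outWeight]
  split_ifs <;> simp

/-- The linear combination `uᵀ Φ` of the factors. -/
def linFeat (u : G.Param) (s : G.State) : ℝ := ∑ f, u f * G.factor f s

theorem weight_add_smul (Θ v : G.Param) (t : ℝ) (s : G.State) :
    G.weight (Θ + t • v) s = G.weight Θ s * Real.exp (t * G.linFeat v s) := by
  rw [weight, weight, ← Real.exp_add, linFeat, Finset.mul_sum, ← Finset.sum_add_distrib]
  congr 1
  refine Finset.sum_congr rfl fun f _ => ?_
  simp only [PiLp.add_apply, PiLp.smul_apply, smul_eq_mul]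
  ring

theorem outWeight_add_smul (Θ v : G.Param) (t : ℝ) (o : G.Out) (s : G.State) :
    G.outWeight (Θ + t • v) o s = G.outWeight Θ o s * Real.exp (t * G.linFeat v s) := by
  simp only [outWeight, weight_add_smul]
  split_ifs <;> simp

theorem hasDerivAt_wmean_prob [NeZero k] (Θ v : G.Param) (f : G.State → ℝ) (t : ℝ) :
    HasDerivAt (fun τ : ℝ => wmean (G.prob (Θ + τ • v)) f)
      (wcov (G.prob (Θ + t • v)) f (G.linFeat v)) t := by
  have h := hasDerivAt_wmean_gibbs (G.weight Θ) f (G.linFeat v) t (by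
    simp only [← weight_add_smul]
    exact (G.sum_weight_pos _).ne')
  simp only [← weight_add_smul] at h
  exact h

theorem hasDerivAt_wmean_condProb [NeZero k] (Θ v : G.Param) (o : G.Out) (f : G.State → ℝ)
    (t : ℝ) :
    HasDerivAt (fun τ : ℝ => wmean (G.condProb (Θ + τ • v) o) f)
      (wcov (G.condProb (Θ + t • v) o) f (G.linFeat v)) t := by
  have h := hasDerivAt_wmean_gibbs (G.outWeight Θ o) f (G.linFeat v) t (by
    simp only [← outWeight_add_smul]
    exact (G.sum_weight_out_pos _ o).ne')
  simp only [← outWeight_add_smul] at h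
  simpa only [condProb_eq_gibbs] using h

/-! ### Independent samples of the model, and the information inequality -/

variable {m : ℕ}

theorem sampleProb_nonneg [NeZero k] (Θ : G.Param) (d : Fin m → G.State) :
    0 ≤ G.sampleProb Θ d := Finset.prod_nonneg fun _ _ => G.prob_nonneg Θ _

theorem sum_sampleProb [NeZero k] (Θ : G.Param) : ∑ d : Fin m → G.State, G.sampleProb Θ d = 1 := by
  simp only [sampleProb]
  rw [← Fintype.sum_pow, G.sum_prob, one_pow]

theorem sampleProb_eq_gibbs (Θ : G.Param) :
    G.sampleProb (m := m) Θ = gibbs fun d => ∏ t, G.weight Θ (d t) := by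
  funext d
  simp only [sampleProb, gibbs, prob, Finset.prod_div_distrib, Finset.prod_const, Finset.card_univ,
    Fintype.card_fin]
  rw [Fintype.sum_pow]

/-- Independent samples again form an exponential family, whose statistic is the sum of the
individual ones. -/
theorem hasDerivAt_wmean_sampleProb [NeZero k] (Θ v : G.Param) (f : (Fin m → G.State) → ℝ) (t : ℝ) :
    HasDerivAt (fun τ : ℝ => wmean (G.sampleProb (Θ + τ • v)) f)
      (wcov (G.sampleProb (Θ + t • v)) f fun d => ∑ r, G.linFeat v (d r)) t := by
  have e : ∀ (τ : ℝ) (d : Fin m → G.State), (∏ r, G.weight Θ (d r)) *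
      Real.exp (τ * ∑ r, G.linFeat v (d r)) = ∏ r, G.weight (Θ + τ • v) (d r) := by
    intro τ d
    simp only [weight_add_smul, Finset.prod_mul_distrib, ← Real.exp_sum, Finset.mul_sum]
  have h := hasDerivAt_wmean_gibbs (fun d : Fin m → G.State => ∏ r, G.weight Θ (d r)) f
    (fun d => ∑ r, G.linFeat v (d r)) t (by
      simp only [e]
      rw [← Fintype.sum_pow]
      exact (pow_pos (G.sum_weight_pos _) _).ne')
  simp only [e] at h
  simpa only [sampleProb_eq_gibbs] using h

/-- Additivity of the variance without expanding the sums: both sides are the derivative at `Θ` of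
the mean of the summed statistic. -/
theorem wcov_sampleProb_sum [NeZero k] (Θ v : G.Param) :
    wcov (G.sampleProb (m := m) Θ) (fun d => ∑ r, G.linFeat v (d r))
      (fun d => ∑ r, G.linFeat v (d r)) = m * wcov (G.prob Θ) (G.linFeat v) (G.linFeat v) := by
  have h1 := G.hasDerivAt_wmean_sampleProb Θ v (fun d : Fin m → G.State => ∑ r, G.linFeat v (d r)) 0
  have h2 := (G.hasDerivAt_wmean_prob Θ v (G.linFeat v) 0).const_mul (m : ℝ)
  have e : ∀ τ : ℝ, wmean (G.sampleProb (Θ + τ • v))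
      (fun d : Fin m → G.State => ∑ r, G.linFeat v (d r)) =
      m * wmean (G.prob (Θ + τ • v)) (G.linFeat v) := fun τ =>
    sum_prod_mul_sum (G.sum_prob _) _ m
  simp only [e] at h1
  simpa using h1.unique h2

/-- The information inequality: an efficient estimator bounds the covariance of the factors from
below. -/
theorem EfficientEstimator.le_wcov {G : WIS k khat n} [NeZero k] {F : Set G.Param} {c : ℝ}
    (hc : 0 < c) (hm : 0 < m) (heff : G.EfficientEstimator F c m) {Θ : G.Param} (hΘ : Θ ∈ F)
    (u : G.Param) : 2 * c * ‖u‖ ^ 2 ≤ wcov (G.prob Θ) (G.linFeat u) (G.linFeat u) := by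
  obtain ⟨T, ⟨-, hder⟩, hcov⟩ := heff Θ hΘ
  have hline : HasDerivAt (fun τ : ℝ => Θ + τ • u) u 0 := by
    simpa using ((hasDerivAt_id (0 : ℝ)).smul_const u).const_add Θ
  -- Since the bias has zero derivative, the mean of `T` moves like the parameter itself. Below, the
  -- same derivative is computed as a covariance with the summed statistic, to which Cauchy–Schwarz
  -- applies.
  have h1 : HasDerivAt (fun τ : ℝ => inner ℝ u (G.estMean T (Θ + τ • u))) (‖u‖ ^ 2) 0 := by
    have h := (innerSL ℝ u).hasFDerivAt.comp_hasDerivAt (0 : ℝ)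
      (HasFDerivAt.comp_hasDerivAt (l := G.estMean T) (0 : ℝ) (by simpa using hder) hline)
    simpa [Function.comp_def, real_inner_self_eq_norm_sq] using h
  have e : ∀ τ : ℝ, inner ℝ u (G.estMean T (Θ + τ • u)) =
      wmean (G.sampleProb (Θ + τ • u)) fun d => inner ℝ u (T d) := by
    intro τ
    simp only [estMean, wmean, inner_sum, inner_smul_right]
  simp only [e] at h1
  have h2 := h1.unique (G.hasDerivAt_wmean_sampleProb Θ u (fun d => inner ℝ u (T d)) 0)
  simp only [zero_smul, add_zero] at h2
  have h3 := wcov_sq_le (G.sampleProb_nonneg (m := m) Θ) (fun d => inner ℝ u (T d))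
    (fun d => ∑ r, G.linFeat u (d r))
  rw [← h2, wcov_sampleProb_sum] at h3
  have h4 : wcov (G.sampleProb Θ) (fun d => inner ℝ u (T d)) (fun d => inner ℝ u (T d)) ≤
      1 / (2 * c * m) * ‖u‖ ^ 2 := by
    rw [wcov_self_eq_sum_sq (G.sum_sampleProb Θ)]
    have := hcov u
    have e0 := e 0
    simp only [zero_smul, add_zero] at e0
    simpa only [inner_sub_right, e0] using this
  set V := wcov (G.prob Θ) (G.linFeat u) (G.linFeat u)
  have hV : 0 ≤ V := wcov_self_nonneg (G.prob_nonneg Θ) _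
  have hm' : (0 : ℝ) < m := by exact_mod_cast hm
  have h5 : (‖u‖ ^ 2) ^ 2 ≤ 1 / (2 * c * m) * ‖u‖ ^ 2 * (m * V) :=
    h3.trans (mul_le_mul_of_nonneg_right h4 (by positivity))
  rcases (sq_nonneg ‖u‖).eq_or_lt with h0 | h0
  · rw [← h0, mul_zero]
    exact hV
  · have h6 : ‖u‖ ^ 2 * (2 * c * ‖u‖ ^ 2) ≤ ‖u‖ ^ 2 * V := by
      calc ‖u‖ ^ 2 * (2 * c * ‖u‖ ^ 2) = 2 * c * (‖u‖ ^ 2) ^ 2 := by ring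
        _ ≤ 2 * c * (1 / (2 * c * m) * ‖u‖ ^ 2 * (m * V)) := by gcongr
        _ = ‖u‖ ^ 2 * V := by field_simp
    exact le_of_mul_le_mul_left h6 h0

end WIS

/-! ### Sums over constrained index sets. -/

theorem sum_subtype_eq_sum_ite {ι : Type*} [Fintype ι] (p : ι → Prop) [DecidablePred p]
    (f : ι → ℝ) : ∑ q : {q // p q}, f q.1 = ∑ q, if p q then f q else 0 := by
  rw [← Finset.sum_filter]
  exact (Finset.sum_subtype _ (by simp) f).symm

/-- A sum over ordered pairs of a quantity that is additive in the two members. -/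
theorem sum_lt_pairs_add {N : ℕ} (a : Fin N → ℝ) :
    ∑ p : {p : Fin N × Fin N // p.1 < p.2}, (a p.1.1 + a p.1.2) = ((N : ℝ) - 1) * ∑ i, a i := by
  have h1 : ∑ p : {p : Fin N × Fin N // p.1 < p.2}, (a p.1.1 + a p.1.2) =
      ∑ i, ∑ j, if i < j then a i + a j else 0 := by
    rw [← Fintype.sum_prod_type' (f := fun i j => if i < j then a i + a j else 0)]
    exact sum_subtype_eq_sum_ite (fun p : Fin N × Fin N => p.1 < p.2) fun p => a p.1 + a p.2
  have h2 : ∑ i, ∑ j, (if i < j then a i + a j else 0) =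
      ∑ i, ∑ j, (if i < j then a i else 0) + ∑ i, ∑ j, (if j < i then a i else 0) := by
    rw [Finset.sum_comm (f := fun i j => if j < i then a i else 0), ← Finset.sum_add_distrib]
    refine Finset.sum_congr rfl fun i _ => ?_
    rw [← Finset.sum_add_distrib]
    refine Finset.sum_congr rfl fun j _ => ?_
    split_ifs <;> simp
  rw [h1, h2, ← Finset.sum_add_distrib, Finset.mul_sum]
  refine Finset.sum_congr rfl fun i _ => ?_
  rw [← Finset.sum_add_distrib]
  -- The index `i` is comparable with every `j` except itself, hence the factor `N - 1`.
  have h3 : ∀ j, ((if i < j then a i else 0) + if j < i then a i else 0) =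
      a i - if i = j then a i else 0 := by
    intro j
    rcases lt_trichotomy i j with h | h | h
    · simp [h, h.not_gt, h.ne]
    · simp [h]
    · simp [h, h.not_gt, h.ne']
  simp only [h3, Finset.sum_sub_distrib, Finset.sum_const, Finset.card_univ, Fintype.card_fin,
    nsmul_eq_mul, Finset.sum_ite_eq, Finset.mem_univ, if_true]
  ring

namespace WIS

variable {k khat n : ℕ} (G : WIS k khat n)

/-! ### Increments of the factors -/

/-- Up to sign the factor is the indicator of one joint value of the two bits: it changes by at most
one, and only if a bit changes. -/
theorem relFactor_sub_sq_le (r : LabelRel) (a b a' b' : Bool) :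
    (relFactor r a b - relFactor r a' b') ^ 2 ≤
      ((if a = true then (1 : ℝ) else 0) - if a' = true then 1 else 0) ^ 2 +
        ((if b = true then (1 : ℝ) else 0) - if b' = true then 1 else 0) ^ 2 := by
  cases r <;> cases a <;> cases b <;> cases a' <;> cases b' <;> norm_num [relFactor]

theorem abs_relFactor_sub_le (r : LabelRel) (a b a' b' : Bool) :
    |relFactor r a b - relFactor r a' b'| ≤ (relFactor r a b - relFactor r a' b') ^ 2 := by
  cases r <;> cases a <;> cases b <;> cases a' <;> cases b' <;> norm_num [relFactor]

theorem relFactor_sub_sq_le_one (r : LabelRel) (a b a' b' : Bool) :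
    (relFactor r a b - relFactor r a' b') ^ 2 ≤ 1 := by
  cases r <;> cases a <;> cases b <;> cases a' <;> cases b' <;> norm_num [relFactor]

/-- Increments lie in `{0, 1, -1}`. This lets `abs_wcov_le_two_mul` bound a covariance by the
variance itself rather than by its square root, matching the squared variances in `posteriorSpread`.
-/
theorem abs_factor_sub_le (f : G.Factor) (s s' : G.State) :
    |G.factor f s - G.factor f s'| ≤ (G.factor f s - G.factor f s') ^ 2 := by
  rcases f with p | p | p | p
  · simp only [factor]
    split_ifs <;> norm_num
  · simp only [factor]
    split_ifs <;> norm_num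
  · exact abs_relFactor_sub_le _ _ _ _ _
  · exact abs_relFactor_sub_le _ _ _ _ _

theorem factor_sub_sq_le_one (f : G.Factor) (s s' : G.State) :
    (G.factor f s - G.factor f s') ^ 2 ≤ 1 := by
  rcases f with p | p | p | p
  · simp only [factor]
    split_ifs <;> norm_num
  · simp only [factor]
    split_ifs <;> norm_num
  · exact relFactor_sub_sq_le_one _ _ _ _ _
  · exact relFactor_sub_sq_le_one _ _ _ _ _

/-- Each of the `M` coordinates moves by at most one. This bounds the stochastic gradients. -/
theorem norm_feat_sub_sq_le (s s' : G.State) :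
    ‖G.feat s - G.feat s'‖ ^ 2 ≤ G.numFactors := by
  rw [EuclideanSpace.norm_sq_eq]
  calc ∑ f, ‖(G.feat s - G.feat s') f‖ ^ 2 ≤ ∑ _f : G.Factor, (1 : ℝ) :=
        Finset.sum_le_sum fun f _ => by
          simpa [feat] using G.factor_sub_sq_le_one f s s'
    _ = G.numFactors := by simp [numFactors]

theorem inner_feat (u : G.Param) (s : G.State) : inner ℝ u (G.feat s) = G.linFeat u s := by
  simp [PiLp.inner_apply, feat, linFeat, mul_comm]

/-! ### Posterior variances of the factors -/

/-- The indicator of the desired label `y`. -/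
def labelInd (y : Fin k) (s : G.State) : ℝ := if s.1 = y then 1 else 0

/-- The indicator of the seen label `i`. -/
def seenInd (i : Fin khat) (s : G.State) : ℝ := if s.2.1 i = true then 1 else 0

theorem condVar_eq_wcov [NeZero k] (Θ : G.Param) (o : G.Out) (g : G.State → ℝ) :
    G.condVar Θ o g = wcov (G.condProb Θ o) g g :=
  (wcov_self_eq_sum_sq (G.sum_condProb Θ o) g).symm

theorem out_eq_of_condProb_ne_zero {G : WIS k khat n} {Θ : G.Param} {o : G.Out} {s : G.State}
    (h : G.condProb Θ o s ≠ 0) : s.2.2 = o := by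
  by_contra h'
  exact h (by simp [condProb, h'])

/-- Given the outputs, the factor is either the indicator of `y` or zero. Keeping the `if` matters:
for each `y` and `j` at most one label survives, so labeling functions are counted rather than
labels. -/
theorem wcov_pseudoAccuracy_le [NeZero k] (Θ : G.Param) (o : G.Out)
    (p : {p : G.Known × Fin n × Fin khat // p.2.2 ∈ G.nonExcl p.1 p.2.1}) :
    wcov (G.condProb Θ o) (G.factor (.inl p)) (G.factor (.inl p)) ≤
      if (o p.1.2.1).1 = p.1.2.2 then
        wcov (G.condProb Θ o) (G.labelInd p.1.1.1) (G.labelInd p.1.1.1) else 0 := by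
  split_ifs with ho
  · refine wcov_self_le (G.condProb_nonneg Θ o) fun s s' hs hs' => ?_
    simp [factor, labelInd, out_eq_of_condProb_ne_zero hs, out_eq_of_condProb_ne_zero hs', ho]
  · refine (wcov_self_le (g := fun _ => 0) (G.condProb_nonneg Θ o) fun s s' hs hs' => ?_).trans
      (by simp [wcov])
    simp [factor, out_eq_of_condProb_ne_zero hs, out_eq_of_condProb_ne_zero hs', ho]

theorem wcov_accuracy_le [NeZero k] (Θ : G.Param) (o : G.Out)
    (p : {p : Fin n × Fin khat // p.2 ∈ G.space p.1}) :
    wcov (G.condProb Θ o) (G.factor (.inr (.inl p))) (G.factor (.inr (.inl p))) ≤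
      wcov (G.condProb Θ o) (G.seenInd p.1.2) (G.seenInd p.1.2) := by
  refine wcov_self_le (G.condProb_nonneg Θ o) fun s s' hs hs' => ?_
  simp only [factor, seenInd, out_eq_of_condProb_ne_zero hs, out_eq_of_condProb_ne_zero hs']
  split_ifs <;> simp_all

theorem wcov_seenRelation_le [NeZero k] (Θ : G.Param) (o : G.Out)
    (p : {p : Fin khat × Fin khat // p.1 < p.2}) :
    wcov (G.condProb Θ o) (G.factor (.inr (.inr (.inl p)))) (G.factor (.inr (.inr (.inl p)))) ≤
      wcov (G.condProb Θ o) (G.seenInd p.1.1) (G.seenInd p.1.1) +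
        wcov (G.condProb Θ o) (G.seenInd p.1.2) (G.seenInd p.1.2) :=
  wcov_self_le_add (G.condProb_nonneg Θ o) fun _ _ _ _ => relFactor_sub_sq_le _ _ _ _ _

theorem wcov_labelRelation_le [NeZero k] (Θ : G.Param) (o : G.Out) (p : G.Known × Fin khat) :
    wcov (G.condProb Θ o) (G.factor (.inr (.inr (.inr p)))) (G.factor (.inr (.inr (.inr p)))) ≤
      wcov (G.condProb Θ o) (G.labelInd p.1.1) (G.labelInd p.1.1) +
        wcov (G.condProb Θ o) (G.seenInd p.2) (G.seenInd p.2) :=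
  wcov_self_le_add (G.condProb_nonneg Θ o) fun s s' _ _ => by
    simpa [factor, labelInd, seenInd] using relFactor_sub_sq_le
      (G.rel (Sum.inl p.1.1) (Sum.inr p.2)) (decide (s.1 = p.1.1)) (s.2.1 p.2)
      (decide (s'.1 = p.1.1)) (s'.2.1 p.2)

/-- The squared posterior variances of the factors are controlled by those of the latent
variables. -/
theorem sum_wcov_factor_sq_le [NeZero k] (Θ : G.Param) (o : G.Out) :
    ∑ f, wcov (G.condProb Θ o) (G.factor f) (G.factor f) ^ 2 ≤ 2 * G.posteriorSpread Θ o := by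
  set p := G.condProb Θ o with hp
  set a : Fin k → ℝ := fun y => wcov p (G.labelInd y) (G.labelInd y) with ha
  set b : Fin khat → ℝ := fun i => wcov p (G.seenInd i) (G.seenInd i) with hb
  have hn : ∀ f, 0 ≤ wcov p f f := wcov_self_nonneg (G.condProb_nonneg Θ o)
  -- A relation factor is charged to two latent variables; squaring that bound is the source of the
  -- factor `2` in the conclusion.
  have hadd : ∀ x y z : ℝ, 0 ≤ x → x ≤ y + z → x ^ 2 ≤ 2 * y ^ 2 + 2 * z ^ 2 := by
    intro x y z h1 h2
    nlinarith [sq_nonneg (y - z), mul_self_le_mul_self h1 h2]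
  have hS : G.posteriorSpread Θ o =
      (∑ y : G.Known, ((G.numNonExcl y : ℝ) + khat) * a y.1 ^ 2) +
        ∑ i, ((G.numCover i : ℝ) + ((khat : ℝ) + Fintype.card G.Known) - 1) * b i ^ 2 := by
    simp only [posteriorSpread, condVar_eq_wcov]
    rfl
  have h1 : ∑ q : {q : G.Known × Fin n × Fin khat // q.2.2 ∈ G.nonExcl q.1 q.2.1},
      wcov p (G.factor (.inl q)) (G.factor (.inl q)) ^ 2 ≤
        ∑ y : G.Known, (G.numNonExcl y : ℝ) * a y.1 ^ 2 := by
    calc _ ≤ ∑ q : {q : G.Known × Fin n × Fin khat // q.2.2 ∈ G.nonExcl q.1 q.2.1},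
          (if (o q.1.2.1).1 = q.1.2.2 then a q.1.1.1 ^ 2 else 0) := by
          refine Finset.sum_le_sum fun q _ => ?_
          have h := pow_le_pow_left₀ (hn _) (G.wcov_pseudoAccuracy_le Θ o q) 2
          refine h.trans (le_of_eq ?_)
          split_ifs <;> simp [ha, hp]
      _ = ∑ y : G.Known, ∑ j, ∑ i, (if i ∈ G.nonExcl y j then
            (if (o j).1 = i then a y.1 ^ 2 else 0) else 0) := by
          simp only [← Fintype.sum_prod_type']
          exact sum_subtype_eq_sum_ite
            (fun q : G.Known × Fin n × Fin khat => q.2.2 ∈ G.nonExcl q.1 q.2.1)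
            fun q => if (o q.2.1).1 = q.2.2 then a q.1.1 ^ 2 else 0
      _ ≤ ∑ y : G.Known, ∑ j, (if (G.nonExcl y j).Nonempty then a y.1 ^ 2 else 0) := by
          refine Finset.sum_le_sum fun y _ => Finset.sum_le_sum fun j _ => ?_
          have e : ∀ i, (if i ∈ G.nonExcl y j then
              (if (o j).1 = i then a y.1 ^ 2 else 0) else 0) =
              if (o j).1 = i then (if (o j).1 ∈ G.nonExcl y j then a y.1 ^ 2 else 0) else 0 := by
            intro i
            by_cases h : (o j).1 = i
            · simp [← h]
            · simp [h]
          simp only [e, Finset.sum_ite_eq, Finset.mem_univ, if_true]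
          split_ifs with h h'
          · exact le_rfl
          · exact absurd ⟨_, h⟩ h'
          · positivity
          · exact le_rfl
      _ = ∑ y : G.Known, (G.numNonExcl y : ℝ) * a y.1 ^ 2 := by
          refine Finset.sum_congr rfl fun y _ => ?_
          rw [← Finset.sum_filter, Finset.sum_const, nsmul_eq_mul, numNonExcl]
  have h2 : ∑ q : {q : Fin n × Fin khat // q.2 ∈ G.space q.1},
      wcov p (G.factor (.inr (.inl q))) (G.factor (.inr (.inl q))) ^ 2 ≤
        ∑ i, (G.numCover i : ℝ) * b i ^ 2 := by
    calc _ ≤ ∑ q : {q : Fin n × Fin khat // q.2 ∈ G.space q.1}, b q.1.2 ^ 2 :=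
          Finset.sum_le_sum fun q _ => pow_le_pow_left₀ (hn _) (G.wcov_accuracy_le Θ o q) 2
      _ = ∑ j, ∑ i, (if i ∈ G.space j then b i ^ 2 else 0) := by
          simp only [← Fintype.sum_prod_type']
          exact sum_subtype_eq_sum_ite (fun q : Fin n × Fin khat => q.2 ∈ G.space q.1)
            fun q => b q.2 ^ 2
      _ = ∑ i, (G.numCover i : ℝ) * b i ^ 2 := by
          rw [Finset.sum_comm]
          refine Finset.sum_congr rfl fun i _ => ?_
          rw [← Finset.sum_filter, Finset.sum_const, nsmul_eq_mul, numCover]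
  have h3 : ∑ q : {q : Fin khat × Fin khat // q.1 < q.2},
      wcov p (G.factor (.inr (.inr (.inl q)))) (G.factor (.inr (.inr (.inl q)))) ^ 2 ≤
        ((khat : ℝ) - 1) * ∑ i, 2 * b i ^ 2 := by
    rw [← sum_lt_pairs_add]
    exact Finset.sum_le_sum fun q _ => hadd _ _ _ (hn _) (G.wcov_seenRelation_le Θ o q)
  have h4 : ∑ q : G.Known × Fin khat,
      wcov p (G.factor (.inr (.inr (.inr q)))) (G.factor (.inr (.inr (.inr q)))) ^ 2 ≤
        ∑ y : G.Known, (khat : ℝ) * (2 * a y.1 ^ 2) +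
          ∑ i, (Fintype.card G.Known : ℝ) * (2 * b i ^ 2) := by
    calc _ ≤ ∑ q : G.Known × Fin khat, (2 * a q.1.1 ^ 2 + 2 * b q.2 ^ 2) :=
          Finset.sum_le_sum fun q _ => hadd _ _ _ (hn _) (G.wcov_labelRelation_le Θ o q)
      _ = _ := by
          rw [Fintype.sum_prod_type]
          simp only [Finset.sum_add_distrib, Finset.sum_const, Finset.card_univ, Fintype.card_fin,
            nsmul_eq_mul, Finset.mul_sum]
  -- The two accuracy groups are bounded with factor one; nonnegativity permits doubling them as
  -- well.
  have hpos1 : 0 ≤ ∑ y : G.Known, (G.numNonExcl y : ℝ) * a y.1 ^ 2 :=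
    Finset.sum_nonneg fun _ _ => by positivity
  have hpos2 : 0 ≤ ∑ i, (G.numCover i : ℝ) * b i ^ 2 :=
    Finset.sum_nonneg fun _ _ => by positivity
  rw [Fintype.sum_sum_type, Fintype.sum_sum_type, Fintype.sum_sum_type, hS]
  have e1 : ∑ y : G.Known, ((G.numNonExcl y : ℝ) + khat) * a y.1 ^ 2 =
      ∑ y : G.Known, (G.numNonExcl y : ℝ) * a y.1 ^ 2 + khat * ∑ y : G.Known, a y.1 ^ 2 := by
    rw [Finset.mul_sum, ← Finset.sum_add_distrib]
    exact Finset.sum_congr rfl fun _ _ => by ring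
  have e2 : ∑ i, ((G.numCover i : ℝ) + ((khat : ℝ) + Fintype.card G.Known) - 1) * b i ^ 2 =
      ∑ i, (G.numCover i : ℝ) * b i ^ 2 + ((khat : ℝ) - 1) * ∑ i, b i ^ 2 +
        Fintype.card G.Known * ∑ i, b i ^ 2 := by
    rw [Finset.mul_sum, Finset.mul_sum, ← Finset.sum_add_distrib, ← Finset.sum_add_distrib]
    exact Finset.sum_congr rfl fun _ _ => by ring
  rw [e1, e2]
  simp only [← Finset.mul_sum] at h3 h4
  linarith

/-- The posterior variance of a linear combination of the factors. -/
theorem wcov_condProb_linFeat_le [NeZero k] (Θ : G.Param) (o : G.Out) (u : G.Param) :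
    wcov (G.condProb Θ o) (G.linFeat u) (G.linFeat u) ≤
      ‖u‖ ^ 2 * (√(2 * G.numFactors) * √(G.posteriorSpread Θ o)) := by
  have h1 := wcov_sum_self_le (G.condProb_nonneg Θ o) u G.factor
  have hu : ∑ f, u f ^ 2 = ‖u‖ ^ 2 := by
    rw [EuclideanSpace.norm_sq_eq]
    simp
  rw [hu] at h1
  refine h1.trans (mul_le_mul_of_nonneg_left ?_ (sq_nonneg _))
  have hspread := G.sum_wcov_factor_sq_le Θ o
  have hnum : (Finset.univ : Finset G.Factor).card = G.numFactors := Finset.card_univ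
  -- Cauchy–Schwarz over the `M` factors turns the sum of variances into the root of the sum of
  -- their squares, at the cost of `√M`.
  have h2 := sq_sum_le_card_mul_sum_sq (s := (Finset.univ : Finset G.Factor))
    (f := fun f => wcov (G.condProb Θ o) (G.factor f) (G.factor f))
  rw [hnum] at h2
  rw [← Real.sqrt_mul (by positivity)]
  refine Real.le_sqrt_of_sq_le (h2.trans ?_)
  calc (G.numFactors : ℝ) * _ ≤ G.numFactors * (2 * G.posteriorSpread Θ o) := by gcongr
    _ = _ := by ring

/-- The posterior covariance of a bounded function with a linear combination of the factors. -/
theorem wcov_condProb_bounded_linFeat_le [NeZero k] (Θ : G.Param) (o : G.Out) (u : G.Param)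
    {a : G.State → ℝ} (ha : ∀ s, |a s| ≤ 1) :
    wcov (G.condProb Θ o) a (G.linFeat u) ≤ ‖u‖ * (2 * (√2 * √(G.posteriorSpread Θ o))) := by
  have e : wcov (G.condProb Θ o) a (G.linFeat u) =
      ∑ f, u f * wcov (G.condProb Θ o) a (G.factor f) := wcov_sum_right _ _ _ _
  have hu : ∑ f, u f ^ 2 = ‖u‖ ^ 2 := by
    rw [EuclideanSpace.norm_sq_eq]
    simp
  have h1 := Finset.sum_mul_sq_le_sq_mul_sq Finset.univ u
    fun f => wcov (G.condProb Θ o) a (G.factor f)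
  rw [← e, hu] at h1
  have h2 : ∑ f, wcov (G.condProb Θ o) a (G.factor f) ^ 2 ≤
      4 * (2 * G.posteriorSpread Θ o) := by
    calc _ ≤ ∑ f, 4 * wcov (G.condProb Θ o) (G.factor f) (G.factor f) ^ 2 := by
          refine Finset.sum_le_sum fun f _ => ?_
          have h := abs_wcov_le_two_mul (G.condProb_nonneg Θ o) ha (G.abs_factor_sub_le f)
          rw [← sq_abs]
          calc _ ≤ (2 * wcov (G.condProb Θ o) (G.factor f) (G.factor f)) ^ 2 :=
                pow_le_pow_left₀ (abs_nonneg _) h 2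
            _ = _ := by ring
      _ ≤ _ := by
          rw [← Finset.mul_sum]
          have := G.sum_wcov_factor_sq_le Θ o
          gcongr
  have hspread : 0 ≤ G.posteriorSpread Θ o := by
    have := (Finset.sum_nonneg fun f _ => sq_nonneg _).trans (G.sum_wcov_factor_sq_le Θ o)
    linarith
  refine abs_le_of_sq_le_sq' ?_ (by positivity) |>.2
  refine h1.trans ((mul_le_mul_of_nonneg_left h2 (sq_nonneg _)).trans (le_of_eq ?_))
  rw [mul_pow, mul_pow, mul_pow, Real.sq_sqrt (by norm_num), Real.sq_sqrt hspread]
  ring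

end WIS

namespace WIS

variable {k khat n : ℕ} (G : WIS k khat n)

/-! ### The law of the outputs -/

theorem outProb_eq_div (Θ : G.Param) (o : G.Out) :
    G.outProb Θ o = (∑ s, G.outWeight Θ o s) / ∑ s, G.weight Θ s := by
  rw [outProb, Finset.sum_div]
  refine Finset.sum_congr rfl fun s _ => ?_
  simp only [outWeight, prob]
  split_ifs <;> simp

theorem outProb_pos [NeZero k] (Θ : G.Param) (o : G.Out) : 0 < G.outProb Θ o := by
  rw [outProb_eq_div]
  exact div_pos (G.sum_weight_out_pos Θ o) (G.sum_weight_pos Θ)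

theorem sum_outProb [NeZero k] (Θ : G.Param) : ∑ o, G.outProb Θ o = 1 := by
  simp only [outProb]
  rw [Finset.sum_comm]
  simpa using G.sum_prob Θ

theorem outProb_mul_condProb [NeZero k] (Θ : G.Param) (o : G.Out) (s : G.State) :
    G.outProb Θ o * G.condProb Θ o s = if s.2.2 = o then G.prob Θ s else 0 := by
  have h : ∑ s, G.outWeight Θ o s ≠ 0 := (G.sum_weight_out_pos Θ o).ne'
  have hZ := (G.sum_weight_pos Θ).ne'
  rw [outProb_eq_div, condProb_eq_gibbs, gibbs]
  have e : G.outWeight Θ o s / ∑ s, G.weight Θ s = if s.2.2 = o then G.prob Θ s else 0 := by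
    simp only [outWeight, prob]
    split_ifs <;> simp
  rw [← e]
  field_simp

/-- The tower property; with `Θ = Θstar` it says that the expected gradient vanishes at the true
parameter. -/
theorem sum_outProb_mul_wmean_condProb [NeZero k] (Θ : G.Param) (f : G.State → ℝ) :
    ∑ o, G.outProb Θ o * wmean (G.condProb Θ o) f = wmean (G.prob Θ) f := by
  simp only [wmean, Finset.mul_sum, ← mul_assoc, outProb_mul_condProb]
  rw [Finset.sum_comm]
  simp

theorem sum_mul_posterior (Θ : G.Param) (o : G.Out) (a : Fin k → ℝ) :
    ∑ y, a y * G.posterior Θ o y = wmean (G.condProb Θ o) fun s => a s.1 := by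
  simp only [posterior, wmean, Finset.mul_sum]
  rw [Finset.sum_comm]
  refine Finset.sum_congr rfl fun s _ => ?_
  simp [mul_comm]

theorem sum_posterior [NeZero k] (Θ : G.Param) (o : G.Out) : ∑ y, G.posterior Θ o y = 1 := by
  have h := G.sum_mul_posterior Θ o fun _ => 1
  simpa [wmean, G.sum_condProb] using h

theorem posterior_nonneg [NeZero k] (Θ : G.Param) (o : G.Out) (y : Fin k) :
    0 ≤ G.posterior Θ o y :=
  Finset.sum_nonneg fun s _ => by
    split_ifs
    · exact G.condProb_nonneg Θ o s
    · exact le_rfl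

theorem outProb_mul_posterior [NeZero k] (Θ : G.Param) (o : G.Out) (y : Fin k) :
    G.outProb Θ o * G.posterior Θ o y = G.labelOutProb Θ y o := by
  simp only [posterior, labelOutProb, Finset.mul_sum]
  refine Finset.sum_congr rfl fun s _ => ?_
  rw [mul_ite, mul_zero, outProb_mul_condProb, ite_and]

theorem sum_labelOutProb [NeZero k] (Θ : G.Param) (o : G.Out) :
    ∑ y, G.labelOutProb Θ y o = G.outProb Θ o := by
  simp only [← outProb_mul_posterior, ← Finset.mul_sum, sum_posterior, mul_one]

/-! ### Concavity of the expected log-likelihood and stability of the posterior -/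

variable {G}

/-- The `√(2M)` of the pointwise bound cancels against the denominator in the variance assumption.
The result is half of what the information inequality provides. -/
theorem sum_outProb_mul_wcov_le [NeZero k] {F : Set G.Param} {Θstar Θ : G.Param} {c : ℝ}
    (hc : 0 < c) (hvar : G.LowPosteriorVariance F Θstar c) (hΘ : Θ ∈ F) (u : G.Param) :
    ∑ o, G.outProb Θstar o * wcov (G.condProb Θ o) (G.linFeat u) (G.linFeat u) ≤
      c * ‖u‖ ^ 2 := by
  calc _ ≤ ∑ o, G.outProb Θstar o *
        (‖u‖ ^ 2 * (√(2 * G.numFactors) * √(G.posteriorSpread Θ o))) :=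
        Finset.sum_le_sum fun o _ => mul_le_mul_of_nonneg_left
          (G.wcov_condProb_linFeat_le Θ o u) (G.outProb_pos _ _).le
    _ = ‖u‖ ^ 2 * √(2 * G.numFactors) *
        ∑ o, G.outProb Θstar o * √(G.posteriorSpread Θ o) := by
        rw [Finset.mul_sum]
        exact Finset.sum_congr rfl fun _ _ => by ring
    _ ≤ ‖u‖ ^ 2 * √(2 * G.numFactors) * (c / √(2 * G.numFactors)) := by
        have := hvar Θ hΘ
        gcongr
    _ ≤ c * ‖u‖ ^ 2 := by
        -- With no factors the denominator is zero and cannot be cancelled, but the left side then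
        -- vanishes.
        rcases (Real.sqrt_nonneg (2 * (G.numFactors : ℝ))).eq_or_lt with h | h
        · rw [← h]
          simp only [mul_zero, zero_mul]
          positivity
        · rw [mul_assoc, mul_div_cancel₀ _ h.ne', mul_comm]

/-- Here the pointwise bound carries no `√M`, so the assumption leaves a gain of `1/√M`. -/
theorem sum_outProb_mul_wcov_bounded_le [NeZero k] {F : Set G.Param} {Θstar Θ : G.Param} {c : ℝ}
    (hvar : G.LowPosteriorVariance F Θstar c) (hΘ : Θ ∈ F) (u : G.Param)
    {a : G.Out → G.State → ℝ} (ha : ∀ o s, |a o s| ≤ 1) :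
    ∑ o, G.outProb Θstar o * wcov (G.condProb Θ o) (a o) (G.linFeat u) ≤
      2 * c / √G.numFactors * ‖u‖ := by
  calc _ ≤ ∑ o, G.outProb Θstar o * (‖u‖ * (2 * (√2 * √(G.posteriorSpread Θ o)))) :=
        Finset.sum_le_sum fun o _ => mul_le_mul_of_nonneg_left
          (G.wcov_condProb_bounded_linFeat_le Θ o u (ha o)) (G.outProb_pos _ _).le
    _ = ‖u‖ * (2 * √2) * ∑ o, G.outProb Θstar o * √(G.posteriorSpread Θ o) := by
        rw [Finset.mul_sum]
        exact Finset.sum_congr rfl fun _ _ => by ring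
    _ ≤ ‖u‖ * (2 * √2) * (c / √(2 * G.numFactors)) := by
        have := hvar Θ hΘ
        gcongr
    _ = 2 * c / √G.numFactors * ‖u‖ := by
        have h2 : √(2 : ℝ) ≠ 0 := by positivity
        rw [Real.sqrt_mul (by norm_num)]
        field_simp

theorem sub_le_of_hasDerivAt_le {φ φ' : ℝ → ℝ} {K : ℝ} (hφ : ∀ t, HasDerivAt φ (φ' t) t)
    (hK : ∀ t ∈ Set.Icc (0 : ℝ) 1, φ' t ≤ K) : φ 1 - φ 0 ≤ K := by
  obtain ⟨t, ht, h⟩ := exists_hasDerivAt_eq_slope φ φ' zero_lt_one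
    (fun x _ => (hφ x).continuousAt.continuousWithinAt) fun x _ => hφ x
  rw [sub_zero, div_one] at h
  exact h ▸ hK t ⟨ht.1.le, ht.2.le⟩

/-- The expected gradient of the marginal log-likelihood points towards the true parameter. -/
theorem drift_le [NeZero k] {F : Set G.Param} (hF : Convex ℝ F) {Θstar Θ : G.Param} {c : ℝ}
    {m : ℕ} (hc : 0 < c) (hm : 0 < m) (heff : G.EfficientEstimator F c m)
    (hvar : G.LowPosteriorVariance F Θstar c) (hΘstar : Θstar ∈ F) (hΘ : Θ ∈ F) :
    ∑ o, G.outProb Θstar o * wmean (G.condProb Θ o) (G.linFeat (Θ - Θstar)) -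
      wmean (G.prob Θ) (G.linFeat (Θ - Θstar)) ≤ -(c * ‖Θ - Θstar‖ ^ 2) := by
  -- The mean value theorem is applied to the gradient component along the segment from `Θstar` to
  -- `Θ`, which lies in `F` by convexity. It starts at zero and has derivative at most `(c - 2c)
  -- ‖v‖²`.
  set v := Θ - Θstar with hv
  have h := sub_le_of_hasDerivAt_le (φ := fun t : ℝ =>
      ∑ o, G.outProb Θstar o * wmean (G.condProb (Θstar + t • v) o) (G.linFeat v) -
        wmean (G.prob (Θstar + t • v)) (G.linFeat v))
    (φ' := fun t : ℝ =>
      ∑ o, G.outProb Θstar o * wcov (G.condProb (Θstar + t • v) o) (G.linFeat v) (G.linFeat v) -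
        wcov (G.prob (Θstar + t • v)) (G.linFeat v) (G.linFeat v))
    (K := -(c * ‖v‖ ^ 2))
    (fun t => (HasDerivAt.fun_sum fun o _ =>
      (G.hasDerivAt_wmean_condProb Θstar v o _ t).const_mul _).fun_sub
        (G.hasDerivAt_wmean_prob Θstar v _ t))
    (fun t ht => by
      have hmem : Θstar + t • v ∈ F := hF.add_smul_sub_mem hΘstar hΘ ht
      have h1 := sum_outProb_mul_wcov_le hc hvar hmem v
      have h2 := heff.le_wcov hc hm hmem v
      linarith)
  have e1 : Θstar + v = Θ := by rw [hv]; abel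
  simpa [sum_outProb_mul_wmean_condProb, e1] using h

/-- The posterior depends on the parameter in a Lipschitz way, on average over the outputs. -/
theorem sum_outProb_mul_posterior_sub_le [NeZero k] {F : Set G.Param} (hF : Convex ℝ F)
    {Θstar Θ : G.Param} {c : ℝ} (hvar : G.LowPosteriorVariance F Θstar c) (hΘstar : Θstar ∈ F)
    (hΘ : Θ ∈ F) {a : G.Out → Fin k → ℝ} (ha : ∀ o y, |a o y| ≤ 1) :
    ∑ o, G.outProb Θstar o * ∑ y, a o y * (G.posterior Θ o y - G.posterior Θstar o y) ≤
      2 * c / √G.numFactors * ‖Θ - Θstar‖ := by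
  set v := Θ - Θstar with hv
  have h := sub_le_of_hasDerivAt_le (φ := fun t : ℝ =>
      ∑ o, G.outProb Θstar o * wmean (G.condProb (Θstar + t • v) o) (fun s => a o s.1))
    (φ' := fun t : ℝ => ∑ o, G.outProb Θstar o *
      wcov (G.condProb (Θstar + t • v) o) (fun s => a o s.1) (G.linFeat v))
    (fun t => HasDerivAt.fun_sum fun o _ =>
      (G.hasDerivAt_wmean_condProb Θstar v o _ t).const_mul _)
    (fun t ht => sum_outProb_mul_wcov_bounded_le hvar (hF.add_smul_sub_mem hΘstar hΘ ht) v
      (a := fun o s => a o s.1) fun o s => ha o s.1)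
  have e1 : Θstar + v = Θ := by rw [hv]; abel
  simp only [one_smul, zero_smul, add_zero, e1] at h
  refine le_trans (le_of_eq ?_) h
  rw [← Finset.sum_sub_distrib]
  refine Finset.sum_congr rfl fun o _ => ?_
  rw [← mul_sub, ← sum_mul_posterior, ← sum_mul_posterior, ← Finset.sum_sub_distrib]
  simp only [mul_sub]

/-! ### One step of stochastic gradient ascent -/

variable (G) in
/-- The mean of `g` after one step of stochastic gradient ascent. -/
def stepMean (F : Set G.Param) (η : ℝ) (o : G.Out) (g : G.Param → ℝ) (Θ : G.Param) : ℝ :=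
  ∑ s, G.prob Θ s * ∑ s', G.condProb Θ o s' * g (G.proj F (Θ + η • (G.feat s' - G.feat s)))

theorem proj_spec {F : Set G.Param} (hFc : IsClosed F) (hF : Convex ℝ F) (hne : F.Nonempty)
    (Θ : G.Param) : G.proj F Θ ∈ F ∧ ∀ u ∈ F, ‖Θ - G.proj F Θ‖ ≤ ‖Θ - u‖ := by
  have h : ∃ v ∈ F, ∀ u ∈ F, ‖Θ - v‖ ≤ ‖Θ - u‖ := by
    obtain ⟨v, hv, hmin⟩ := exists_norm_eq_iInf_of_complete_convex hne hFc.isComplete hF Θ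
    refine ⟨v, hv, fun u hu => ?_⟩
    rw [hmin]
    exact ciInf_le ⟨0, by rintro _ ⟨w, rfl⟩; exact norm_nonneg _⟩ (⟨u, hu⟩ : F)
  rw [proj, dif_pos h]
  exact h.choose_spec

/-- At the nearest point, the residual makes an obtuse or right angle with every direction into `F`.
-/
theorem norm_proj_sub_le {F : Set G.Param} (hFc : IsClosed F) (hF : Convex ℝ F) {u : G.Param}
    (hu : u ∈ F) (Θ : G.Param) : ‖G.proj F Θ - u‖ ≤ ‖Θ - u‖ := by
  obtain ⟨hmem, hmin⟩ := proj_spec hFc hF ⟨u, hu⟩ Θ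
  have : Nonempty F := ⟨⟨u, hu⟩⟩
  have h := (norm_eq_iInf_iff_real_inner_le_zero hF hmem (u := Θ)).1
    (le_antisymm (le_ciInf fun w => hmin w w.2)
      (ciInf_le ⟨0, by rintro _ ⟨w, rfl⟩; exact norm_nonneg _⟩ (⟨_, hmem⟩ : F))) u hu
  refine le_of_sq_le_sq ?_ (norm_nonneg _)
  have e : Θ - u = (Θ - G.proj F Θ) - (u - G.proj F Θ) := by abel
  rw [e, norm_sub_sq_real (Θ - G.proj F Θ), norm_sub_rev (G.proj F Θ)]
  nlinarith [sq_nonneg ‖Θ - G.proj F Θ‖]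

/-- Comparison on `F` suffices because every step ends with a projection onto `F`. -/
theorem stepMean_mono [NeZero k] {F : Set G.Param} (hFc : IsClosed F) (hF : Convex ℝ F)
    (hne : F.Nonempty) (η : ℝ) (o : G.Out) {g g' : G.Param → ℝ} (hg : ∀ Θ ∈ F, g Θ ≤ g' Θ)
    (Θ : G.Param) : G.stepMean F η o g Θ ≤ G.stepMean F η o g' Θ :=
  Finset.sum_le_sum fun _ _ => mul_le_mul_of_nonneg_left
    (Finset.sum_le_sum fun _ _ => mul_le_mul_of_nonneg_left
      (hg _ (proj_spec hFc hF hne _).1) (G.condProb_nonneg _ _ _)) (G.prob_nonneg _ _)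

theorem stepMean_affine [NeZero k] (F : Set G.Param) (η : ℝ) (o : G.Out) (g : G.Param → ℝ)
    (α β : ℝ) (Θ : G.Param) :
    G.stepMean F η o (fun Θ' => α * g Θ' + β) Θ = α * G.stepMean F η o g Θ + β := by
  have h : ∀ s, ∑ s', G.condProb Θ o s' *
      (α * g (G.proj F (Θ + η • (G.feat s' - G.feat s))) + β) =
      α * ∑ s', G.condProb Θ o s' * g (G.proj F (Θ + η • (G.feat s' - G.feat s))) + β := by
    intro s
    simp only [mul_add, Finset.sum_add_distrib, ← Finset.sum_mul, G.sum_condProb, one_mul,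
      Finset.mul_sum]
    congr 1
    exact Finset.sum_congr rfl fun _ _ => by ring
  simp only [stepMean, h]
  simp only [mul_add, Finset.sum_add_distrib, ← Finset.sum_mul, G.sum_prob, one_mul]
  rw [Finset.mul_sum]
  congr 1
  exact Finset.sum_congr rfl fun _ _ => by ring

/-- Expand the square before projection: the cross term averages to `2η` times the drift, and the
quadratic term is at most `η² M`. -/
theorem sum_stepMean_dist_sq_le [NeZero k] {F : Set G.Param} (hFc : IsClosed F)
    (hF : Convex ℝ F) {Θstar Θ : G.Param} {c : ℝ} {m : ℕ} (hc : 0 < c) (hm : 0 < m)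
    (heff : G.EfficientEstimator F c m) (hvar : G.LowPosteriorVariance F Θstar c)
    (hΘstar : Θstar ∈ F) (hΘ : Θ ∈ F) {η : ℝ} (hη : 0 ≤ η) :
    ∑ o, G.outProb Θstar o * G.stepMean F η o (fun Θ' => ‖Θ' - Θstar‖ ^ 2) Θ ≤
      (1 - 2 * η * c) * ‖Θ - Θstar‖ ^ 2 + η ^ 2 * G.numFactors := by
  have hstep : ∀ s s', ‖G.proj F (Θ + η • (G.feat s' - G.feat s)) - Θstar‖ ^ 2 ≤
      (‖Θ - Θstar‖ ^ 2 + η ^ 2 * G.numFactors) +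
        (2 * η * G.linFeat (Θ - Θstar) s' - 2 * η * G.linFeat (Θ - Θstar) s) := by
    intro s s'
    have h1 := pow_le_pow_left₀ (norm_nonneg _) (norm_proj_sub_le hFc hF hΘstar
      (Θ + η • (G.feat s' - G.feat s))) 2
    have e : Θ + η • (G.feat s' - G.feat s) - Θstar =
        (Θ - Θstar) + η • (G.feat s' - G.feat s) := by abel
    rw [e, norm_add_sq_real, inner_smul_right, inner_sub_right, inner_feat, inner_feat, norm_smul,
      mul_pow, Real.norm_eq_abs, sq_abs] at h1
    have h2 := mul_le_mul_of_nonneg_left (G.norm_feat_sub_sq_le s' s) (sq_nonneg η)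
    linarith
  have hone : ∀ o, G.stepMean F η o (fun Θ' => ‖Θ' - Θstar‖ ^ 2) Θ ≤
      (‖Θ - Θstar‖ ^ 2 + η ^ 2 * G.numFactors) +
        2 * η * (wmean (G.condProb Θ o) (G.linFeat (Θ - Θstar)) -
          wmean (G.prob Θ) (G.linFeat (Θ - Θstar))) := by
    intro o
    calc _ ≤ ∑ s, G.prob Θ s * ∑ s', G.condProb Θ o s' *
          ((‖Θ - Θstar‖ ^ 2 + η ^ 2 * G.numFactors) +
            (2 * η * G.linFeat (Θ - Θstar) s' - 2 * η * G.linFeat (Θ - Θstar) s)) :=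
          Finset.sum_le_sum fun s _ => mul_le_mul_of_nonneg_left
            (Finset.sum_le_sum fun s' _ => mul_le_mul_of_nonneg_left (hstep s s')
              (G.condProb_nonneg _ _ _)) (G.prob_nonneg _ _)
      _ = ∑ s, G.prob Θ s * ((‖Θ - Θstar‖ ^ 2 + η ^ 2 * G.numFactors) +
            2 * η * wmean (G.condProb Θ o) (G.linFeat (Θ - Θstar)) -
              2 * η * G.linFeat (Θ - Θstar) s) := by
          refine Finset.sum_congr rfl fun s _ => ?_
          simp only [mul_add, mul_sub, Finset.sum_add_distrib, Finset.sum_sub_distrib,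
            ← Finset.sum_mul, G.sum_condProb, one_mul, wmean, Finset.mul_sum]
          have e : ∀ s', G.condProb Θ o s' * (2 * η * G.linFeat (Θ - Θstar) s') =
            2 * η * (G.condProb Θ o s' * G.linFeat (Θ - Θstar) s') := fun s' => by ring
          simp only [e]
          ring
      _ = _ := by
          simp only [mul_add, mul_sub, Finset.sum_add_distrib, Finset.sum_sub_distrib,
            ← Finset.sum_mul, G.sum_prob, one_mul, wmean]
          have e : ∑ s, G.prob Θ s * (2 * η * G.linFeat (Θ - Θstar) s) =
              2 * η * ∑ s, G.prob Θ s * G.linFeat (Θ - Θstar) s := by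
            rw [Finset.mul_sum]
            exact Finset.sum_congr rfl fun _ _ => by ring
          rw [e]
          ring
  have h := drift_le hF hc hm heff hvar hΘstar hΘ
  calc _ ≤ ∑ o, G.outProb Θstar o * ((‖Θ - Θstar‖ ^ 2 + η ^ 2 * G.numFactors) +
        2 * η * (wmean (G.condProb Θ o) (G.linFeat (Θ - Θstar)) -
          wmean (G.prob Θ) (G.linFeat (Θ - Θstar)))) :=
        Finset.sum_le_sum fun o _ => mul_le_mul_of_nonneg_left (hone o) (G.outProb_pos _ _).le
    _ = (‖Θ - Θstar‖ ^ 2 + η ^ 2 * G.numFactors) + 2 * η *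
        (∑ o, G.outProb Θstar o * wmean (G.condProb Θ o) (G.linFeat (Θ - Θstar)) -
          wmean (G.prob Θ) (G.linFeat (Θ - Θstar))) := by
        have e : ∀ o, G.outProb Θstar o * ((‖Θ - Θstar‖ ^ 2 + η ^ 2 * G.numFactors) +
            2 * η * (wmean (G.condProb Θ o) (G.linFeat (Θ - Θstar)) -
              wmean (G.prob Θ) (G.linFeat (Θ - Θstar)))) =
            G.outProb Θstar o * (‖Θ - Θstar‖ ^ 2 + η ^ 2 * G.numFactors) +
            2 * η * (G.outProb Θstar o * wmean (G.condProb Θ o) (G.linFeat (Θ - Θstar))) -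
            G.outProb Θstar o * (2 * η * wmean (G.prob Θ) (G.linFeat (Θ - Θstar))) := by
          intro o
          ring
        simp only [e, Finset.sum_add_distrib, Finset.sum_sub_distrib, ← Finset.sum_mul,
          ← Finset.mul_sum, G.sum_outProb, one_mul]
        ring
    _ ≤ _ := by nlinarith [mul_le_mul_of_nonneg_left h (by positivity : 0 ≤ 2 * η)]

/-- The feasible set is bounded. -/
theorem dist_sq_le_of_mem [NeZero k] {F : Set G.Param} (hF : Convex ℝ F) {Θstar Θ : G.Param}
    {c : ℝ} {m : ℕ} (hc : 0 < c) (hm : 0 < m) (heff : G.EfficientEstimator F c m)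
    (hvar : G.LowPosteriorVariance F Θstar c) (hΘstar : Θstar ∈ F) (hΘ : Θ ∈ F) :
    ‖Θ - Θstar‖ ^ 2 ≤ G.numFactors / c ^ 2 := by
  have h := drift_le hF hc hm heff hvar hΘstar hΘ
  set v := Θ - Θstar
  -- Values of `linFeat v` differ by at most `‖v‖ √M`, hence so do any two of its averages. The
  -- drift, however, forces a difference of `c ‖v‖²`.
  have hpair : ∀ s s', -(‖v‖ * √G.numFactors) ≤ G.linFeat v s' - G.linFeat v s := by
    intro s s'
    rw [← inner_feat, ← inner_feat, ← inner_sub_right]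
    have h1 := neg_le_of_abs_le (abs_real_inner_le_norm v (G.feat s' - G.feat s))
    have h2 : ‖G.feat s' - G.feat s‖ ≤ √G.numFactors :=
      Real.le_sqrt_of_sq_le (G.norm_feat_sub_sq_le s' s)
    have h3 := mul_le_mul_of_nonneg_left h2 (norm_nonneg v)
    linarith
  have hcond : ∀ o s, -(‖v‖ * √G.numFactors) + G.linFeat v s ≤
      wmean (G.condProb Θ o) (G.linFeat v) := by
    intro o s
    calc _ = ∑ s', G.condProb Θ o s' * (-(‖v‖ * √G.numFactors) + G.linFeat v s) := by
          rw [← Finset.sum_mul, G.sum_condProb, one_mul]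
      _ ≤ _ := Finset.sum_le_sum fun s' _ => mul_le_mul_of_nonneg_left
          (by linarith [hpair s s']) (G.condProb_nonneg _ _ _)
  have hout : ∀ s, -(‖v‖ * √G.numFactors) + G.linFeat v s ≤
      ∑ o, G.outProb Θstar o * wmean (G.condProb Θ o) (G.linFeat v) := by
    intro s
    calc _ = ∑ o, G.outProb Θstar o * (-(‖v‖ * √G.numFactors) + G.linFeat v s) := by
          rw [← Finset.sum_mul, G.sum_outProb, one_mul]
      _ ≤ _ := Finset.sum_le_sum fun o _ => mul_le_mul_of_nonneg_left
          (hcond o s) (G.outProb_pos _ _).le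
  have hprob : wmean (G.prob Θ) (G.linFeat v) ≤ ‖v‖ * √G.numFactors +
      ∑ o, G.outProb Θstar o * wmean (G.condProb Θ o) (G.linFeat v) := by
    calc _ ≤ ∑ s, G.prob Θ s * (‖v‖ * √G.numFactors +
          ∑ o, G.outProb Θstar o * wmean (G.condProb Θ o) (G.linFeat v)) :=
          Finset.sum_le_sum fun s _ => mul_le_mul_of_nonneg_left
            (by linarith [hout s]) (G.prob_nonneg _ _)
      _ = _ := by rw [← Finset.sum_mul, G.sum_prob, one_mul]
  have hmain : c * ‖v‖ ^ 2 ≤ ‖v‖ * √G.numFactors := by linarith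
  have hle : c * ‖v‖ ≤ √G.numFactors := by
    rcases (norm_nonneg v).eq_or_lt with h0 | h0
    · rw [← h0, mul_zero]
      exact Real.sqrt_nonneg _
    · refine le_of_mul_le_mul_left ?_ h0
      linarith
  rw [le_div_iff₀ (by positivity)]
  have h2 := pow_le_pow_left₀ (by positivity) hle 2
  rw [Real.sq_sqrt (by positivity)] at h2
  linarith

end WIS

theorem PMF.toMeasure_bind_fintype {S α : Type*} [Fintype S] [MeasurableSpace α] (p : PMF S)
    (f : S → PMF α) : (p.bind f).toMeasure = ∑ s, p s • (f s).toMeasure := by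
  ext B hB
  rw [PMF.toMeasure_bind_apply _ _ _ hB, tsum_fintype, Measure.finsetSum_apply]
  rfl

namespace WIS

variable {k khat n : ℕ} (G : WIS k khat n)

/-! ### Stochastic gradient ascent over the dataset -/

/-- The mean of `g` after one pass over a list of outputs. -/
def sgdMean (F : Set G.Param) (η : ℝ) (g : G.Param → ℝ) : List G.Out → G.Param → ℝ
  | [], Θ => g Θ
  | o :: L, Θ => G.stepMean F η o (sgdMean F η g L) Θ

/-- The mean of `g` after one pass over `m` independent outputs of `π_Θstar`. -/
def passMean (Θstar : G.Param) (F : Set G.Param) (η : ℝ) (g : G.Param → ℝ) (m : ℕ)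
    (Θ : G.Param) : ℝ :=
  ∑ o : Fin m → G.Out, (∏ t, G.outProb Θstar (o t)) * G.sgdMean F η g (List.ofFn o) Θ

variable {G}

theorem sgdMean_nonneg [NeZero k] (F : Set G.Param) (η : ℝ) {g : G.Param → ℝ} (hg : ∀ Θ, 0 ≤ g Θ)
    (L : List G.Out) (Θ : G.Param) : 0 ≤ G.sgdMean F η g L Θ := by
  induction L generalizing Θ with
  | nil => exact hg Θ
  | cons o L ih =>
    exact Finset.sum_nonneg fun s _ => mul_nonneg (G.prob_nonneg _ _) (Finset.sum_nonneg fun s' _ =>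
      mul_nonneg (G.condProb_nonneg _ _ _) (ih _))

/-- Each step is a finite mixture, so integrals against the law of a pass reduce to the finite
recursion `sgdMean`. -/
theorem lintegral_sgd [NeZero k] (F : Set G.Param) (η : ℝ) {g : G.Param → ℝ} (hg : ∀ Θ, 0 ≤ g Θ)
    (hgm : Measurable g) (L : List G.Out) (Θ : G.Param) :
    ∫⁻ θ, ENNReal.ofReal (g θ) ∂(G.sgd F η L Θ).toMeasure =
      ENNReal.ofReal (G.sgdMean F η g L Θ) := by
  induction L generalizing Θ with
  | nil =>
    rw [sgd, PMF.toMeasure_pure, lintegral_dirac' _ hgm.ennreal_ofReal, sgdMean]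
  | cons o L ih =>
    rw [sgd, sgdStep, PMF.bind_bind, PMF.toMeasure_bind_fintype, lintegral_finsetSum_measure,
      sgdMean, stepMean, ENNReal.ofReal_sum_of_nonneg]
    · refine Finset.sum_congr rfl fun s _ => ?_
      rw [lintegral_smul_measure, PMF.bind_bind, PMF.toMeasure_bind_fintype,
        lintegral_finsetSum_measure, ENNReal.ofReal_mul (G.prob_nonneg _ _),
        ENNReal.ofReal_sum_of_nonneg]
      · simp only [probPMF, PMF.ofFintype_apply, smul_eq_mul]
        congr 1
        refine Finset.sum_congr rfl fun s' _ => ?_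
        rw [lintegral_smul_measure, PMF.pure_bind, ih,
          ENNReal.ofReal_mul (G.condProb_nonneg _ _ _)]
        simp only [condPMF, PMF.ofFintype_apply, smul_eq_mul]
      · exact fun s' _ => mul_nonneg (G.condProb_nonneg _ _ _) (sgdMean_nonneg F η hg _ _)
    · exact fun s _ => mul_nonneg (G.prob_nonneg _ _) (Finset.sum_nonneg fun s' _ =>
        mul_nonneg (G.condProb_nonneg _ _ _) (sgdMean_nonneg F η hg _ _))

theorem stepMean_sum [NeZero k] {ι : Type*} [Fintype ι] (F : Set G.Param) (η : ℝ) (o : G.Out)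
    (α : ι → ℝ) (g : ι → G.Param → ℝ) (Θ : G.Param) :
    G.stepMean F η o (fun Θ' => ∑ i, α i * g i Θ') Θ = ∑ i, α i * G.stepMean F η o (g i) Θ := by
  simp only [stepMean, Finset.mul_sum]
  rw [Finset.sum_comm (s := (Finset.univ : Finset ι))]
  refine Finset.sum_congr rfl fun s _ => ?_
  rw [Finset.sum_comm (s := (Finset.univ : Finset ι))]
  exact Finset.sum_congr rfl fun _ _ => Finset.sum_congr rfl fun _ _ => by ring

theorem passMean_zero (Θstar : G.Param) (F : Set G.Param) (η : ℝ) (g : G.Param → ℝ) (Θ : G.Param) :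
    G.passMean Θstar F η g 0 Θ = g Θ := by
  simp [passMean, sgdMean]

/-- Independence of the outputs allows the first one to be split off, the rest of the pass starting
from the updated parameter. -/
theorem passMean_succ [NeZero k] (Θstar : G.Param) (F : Set G.Param) (η : ℝ) (g : G.Param → ℝ)
    (m : ℕ) (Θ : G.Param) : G.passMean Θstar F η g (m + 1) Θ =
      ∑ o, G.outProb Θstar o * G.stepMean F η o (G.passMean Θstar F η g m) Θ := by
  have e : G.passMean Θstar F η g m = fun Θ' => ∑ o : Fin m → G.Out,
      (∏ t, G.outProb Θstar (o t)) * G.sgdMean F η g (List.ofFn o) Θ' := rfl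
  rw [e, passMean, ← (Fin.consEquiv fun _ => G.Out).sum_comp, Fintype.sum_prod_type]
  refine Finset.sum_congr rfl fun o _ => ?_
  rw [stepMean_sum, Finset.mul_sum]
  refine Finset.sum_congr rfl fun o' _ => ?_
  simp only [Fin.consEquiv, Equiv.coe_fn_mk, Fin.prod_univ_succ, Fin.cons_zero, Fin.cons_succ,
    List.ofFn_succ, sgdMean, mul_assoc]

/-- Iterates never leave `F`. Applied to the squared distance this handles large steps; applied to
the indicator of the complement it gives feasibility. -/
theorem passMean_le_of_le [NeZero k] {F : Set G.Param} (hFc : IsClosed F) (hF : Convex ℝ F)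
    (Θstar : G.Param) (η : ℝ) {g : G.Param → ℝ} {B : ℝ} (hg : ∀ Θ ∈ F, g Θ ≤ B) (m : ℕ)
    {Θ : G.Param} (hΘ : Θ ∈ F) : G.passMean Θstar F η g m Θ ≤ B := by
  induction m generalizing Θ with
  | zero => exact (passMean_zero _ _ _ _ _).trans_le (hg Θ hΘ)
  | succ m ih =>
    rw [passMean_succ]
    calc _ ≤ ∑ o, G.outProb Θstar o * B := by
          refine Finset.sum_le_sum fun o _ => mul_le_mul_of_nonneg_left ?_ (G.outProb_pos _ _).le
          -- The constant `B` is written as an affine function of slope zero so that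
          -- `stepMean_affine` evaluates its mean.
          refine (stepMean_mono hFc hF ⟨Θ, hΘ⟩ η o (g' := fun Θ' => 0 * g Θ' + B)
            (fun Θ' h => ?_) Θ).trans_eq ?_
          · simpa using ih h
          · rw [stepMean_affine]
            simp
      _ = B := by rw [← Finset.sum_mul, G.sum_outProb, one_mul]

/-- Geometric convergence of stochastic gradient ascent, up to an error proportional to the step
size. -/
theorem passMean_dist_sq_le [NeZero k] {F : Set G.Param} (hFc : IsClosed F)
    (hF : Convex ℝ F) {Θstar Θ : G.Param} {c : ℝ} {m : ℕ} (hc : 0 < c) (hm : 0 < m)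
    (heff : G.EfficientEstimator F c m) (hvar : G.LowPosteriorVariance F Θstar c)
    (hΘstar : Θstar ∈ F) (hΘ : Θ ∈ F) {η : ℝ} (hη : 0 ≤ η) (hη1 : 2 * η * c ≤ 1) (N : ℕ) :
    G.passMean Θstar F η (fun Θ' => ‖Θ' - Θstar‖ ^ 2) N Θ ≤
      (1 - 2 * η * c) ^ N * ‖Θ - Θstar‖ ^ 2 +
        η * G.numFactors / (2 * c) * (1 - (1 - 2 * η * c) ^ N) := by
  induction N generalizing Θ with
  | zero => simp [passMean_zero]
  | succ N ih =>
    set r := 1 - 2 * η * c with hr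
    have hr0 : 0 ≤ r ^ N := pow_nonneg (by linarith) N
    rw [passMean_succ]
    calc _ ≤ ∑ o, G.outProb Θstar o *
          (r ^ N * G.stepMean F η o (fun Θ' => ‖Θ' - Θstar‖ ^ 2) Θ +
            η * G.numFactors / (2 * c) * (1 - r ^ N)) := by
          refine Finset.sum_le_sum fun o _ => mul_le_mul_of_nonneg_left ?_ (G.outProb_pos _ _).le
          rw [← stepMean_affine]
          exact stepMean_mono hFc hF ⟨Θ, hΘ⟩ η o (fun Θ' h => ih h) Θ
      _ = r ^ N * ∑ o, G.outProb Θstar o * G.stepMean F η o (fun Θ' => ‖Θ' - Θstar‖ ^ 2) Θ +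
            η * G.numFactors / (2 * c) * (1 - r ^ N) := by
          simp only [mul_add, Finset.sum_add_distrib, ← Finset.sum_mul, G.sum_outProb, one_mul]
          rw [Finset.mul_sum]
          congr 1
          exact Finset.sum_congr rfl fun _ _ => by ring
      _ ≤ r ^ N * (r * ‖Θ - Θstar‖ ^ 2 + η ^ 2 * G.numFactors) +
            η * G.numFactors / (2 * c) * (1 - r ^ N) := by
          have := sum_stepMean_dist_sq_le hFc hF hc hm heff hvar hΘstar hΘ hη
          gcongr
      _ = _ := by
          -- The value `ηM/(2c)` is the fixed point of `x ↦ r x + η² M`.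
          have e : η ^ 2 * G.numFactors = η * G.numFactors / (2 * c) * (1 - r) := by
            rw [hr]
            field_simp
            ring
          rw [e]
          ring

/-! ### The law of the learned parameter -/

variable {X W Ω : Type*} [MeasurableSpace X] [MeasurableSpace W] [MeasurableSpace Ω]

theorem measurable_outputs {lam : (j : Fin n) → X → {i : Fin khat // i ∈ G.space j}}
    (hlam : ∀ j i, MeasurableSet (lam j ⁻¹' {i})) : Measurable (G.outputs lam) :=
  measurable_pi_iff.2 fun j => measurable_to_countable' (hlam j)

theorem measureReal_outputs_eq [NeZero k] {π : Measure (X × Fin k)} [IsProbabilityMeasure π]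
    {lam : (j : Fin n) → X → {i : Fin khat // i ∈ G.space j}}
    (hlam : ∀ j i, MeasurableSet (lam j ⁻¹' {i})) {Θstar : G.Param}
    (hspec : G.WellSpecified π lam Θstar) (o : G.Out) :
    π.real {p | G.outputs lam p.1 = o} = G.outProb Θstar o := by
  rw [← sum_labelOutProb]
  simp only [← hspec _ o]
  have e : {p : X × Fin k | G.outputs lam p.1 = o} =
      ⋃ y ∈ (Finset.univ : Finset (Fin k)), {p | p.2 = y ∧ G.outputs lam p.1 = o} := by
    ext p
    simp
  have hm : Measurable fun p : X × Fin k => G.outputs lam p.1 :=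
    (measurable_outputs hlam).comp measurable_fst
  rw [e, measureReal_biUnion_finset]
  · intro y _ y' _ hyy
    exact Set.disjoint_left.2 fun p hp hp' => hyy (hp.1.symm.trans hp'.1)
  · exact fun y _ => (measurable_snd (measurableSet_singleton y)).inter
      (hm (measurableSet_singleton o))

/-- The pass sees the data only through the outputs, which are i.i.d. with the law `outProb Θstar`
because the model is well specified. -/
theorem IsRun.map_eq [NeZero k] {π : Measure (X × Fin k)} [IsProbabilityMeasure π]
    {lam : (j : Fin n) → X → {i : Fin khat // i ∈ G.space j}}
    (hlam : ∀ j i, MeasurableSet (lam j ⁻¹' {i})) {h : W → X → Fin k → ℝ} {F : Set G.Param}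
    {Θstar Θ₀ : G.Param} (hspec : G.WellSpecified π lam Θstar) {η : ℝ} {m : ℕ} {P : Measure Ω}
    {D : Ω → Fin m → X} {Θhat : Ω → G.Param} {what : Ω → W}
    (hrun : G.IsRun π lam h F Θ₀ η P D Θhat what) :
    P.map Θhat = ∑ o : Fin m → G.Out, ENNReal.ofReal (∏ t, G.outProb Θstar (o t)) •
      (G.sgd F η (List.ofFn o) Θ₀).toMeasure := by
  have hprob : IsProbabilityMeasure (π.map Prod.fst) :=
    Measure.isProbabilityMeasure_map measurable_fst.aemeasurable
  have hout := measurable_outputs hlam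
  have hprob' : IsProbabilityMeasure ((π.map Prod.fst).map (G.outputs lam)) :=
    Measure.isProbabilityMeasure_map hout.aemeasurable
  ext B hB
  have h1 := hrun.law Set.univ B MeasurableSet.univ hB
  rw [Set.preimage_univ, Set.univ_inter, Measure.restrict_univ] at h1
  rw [Measure.map_apply hrun.measurable_Θhat hB, h1, Measure.finsetSum_apply]
  have hq : Measurable fun (x : Fin m → X) t => G.outputs lam (x t) :=
    measurable_pi_iff.2 fun t => hout.comp (measurable_pi_apply t)
  rw [← lintegral_map (μ := Measure.pi fun _ => π.map Prod.fst)
    (f := fun o : Fin m → G.Out => (G.sgd F η (List.ofFn o) Θ₀).toMeasure B)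
    (measurable_of_countable _) hq, Measure.pi_map_pi (fun _ => hout.aemeasurable),
    lintegral_fintype]
  refine Finset.sum_congr rfl fun o _ => ?_
  rw [Measure.pi_singleton, Measure.smul_apply, smul_eq_mul, mul_comm,
    ENNReal.ofReal_prod_of_nonneg fun t _ => (G.outProb_pos _ _).le]
  congr 1
  refine Finset.prod_congr rfl fun t _ => ?_
  rw [Measure.map_apply hout (measurableSet_singleton _),
    Measure.map_apply measurable_fst (hout (measurableSet_singleton _)),
    ← measureReal_outputs_eq hlam hspec, ofReal_measureReal]
  rfl

/-- Expectations of functions of the learned parameter. -/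
theorem IsRun.integral_comp [NeZero k] {π : Measure (X × Fin k)} [IsProbabilityMeasure π]
    {lam : (j : Fin n) → X → {i : Fin khat // i ∈ G.space j}}
    (hlam : ∀ j i, MeasurableSet (lam j ⁻¹' {i})) {h : W → X → Fin k → ℝ} {F : Set G.Param}
    {Θstar Θ₀ : G.Param} (hspec : G.WellSpecified π lam Θstar) {η : ℝ} {m : ℕ} {P : Measure Ω}
    {D : Ω → Fin m → X} {Θhat : Ω → G.Param} {what : Ω → W}
    (hrun : G.IsRun π lam h F Θ₀ η P D Θhat what) {g : G.Param → ℝ} (hg : ∀ Θ, 0 ≤ g Θ)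
    (hgm : Measurable g) :
    Integrable (fun ω => g (Θhat ω)) P ∧
      ∫ ω, g (Θhat ω) ∂P = G.passMean Θstar F η g m Θ₀ := by
  have hpos : ∀ o : Fin m → G.Out, 0 ≤ ∏ t, G.outProb Θstar (o t) := fun o =>
    Finset.prod_nonneg fun t _ => (G.outProb_pos _ _).le
  have h1 : ∫⁻ ω, ENNReal.ofReal (g (Θhat ω)) ∂P =
      ENNReal.ofReal (G.passMean Θstar F η g m Θ₀) := by
    rw [← lintegral_map (f := fun θ => ENNReal.ofReal (g θ)) hgm.ennreal_ofReal
      hrun.measurable_Θhat, hrun.map_eq hlam hspec, lintegral_finsetSum_measure, passMean,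
      ENNReal.ofReal_sum_of_nonneg fun o _ => mul_nonneg (hpos o) (sgdMean_nonneg F η hg _ _)]
    refine Finset.sum_congr rfl fun o _ => ?_
    rw [lintegral_smul_measure, lintegral_sgd F η hg hgm, ENNReal.ofReal_mul (hpos o), smul_eq_mul]
  have hmeas : Measurable fun ω => g (Θhat ω) := hgm.comp hrun.measurable_Θhat
  refine ⟨(lintegral_ofReal_ne_top_iff_integrable hmeas.aestronglyMeasurable
    (Filter.Eventually.of_forall fun ω => hg _)).1 (h1 ▸ ENNReal.ofReal_ne_top), ?_⟩
  rw [integral_eq_lintegral_of_nonneg_ae (Filter.Eventually.of_forall fun ω => hg _)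
    hmeas.aestronglyMeasurable, h1, ENNReal.toReal_ofReal]
  exact Finset.sum_nonneg fun o _ => mul_nonneg (hpos o) (sgdMean_nonneg F η hg _ _)

/-- The learned parameter is feasible. -/
theorem IsRun.ae_mem [NeZero k] {π : Measure (X × Fin k)} [IsProbabilityMeasure π]
    {lam : (j : Fin n) → X → {i : Fin khat // i ∈ G.space j}}
    (hlam : ∀ j i, MeasurableSet (lam j ⁻¹' {i})) {h : W → X → Fin k → ℝ} {F : Set G.Param}
    (hFc : IsClosed F) (hF : Convex ℝ F)
    {Θstar Θ₀ : G.Param} (hΘ₀ : Θ₀ ∈ F) (hspec : G.WellSpecified π lam Θstar) {η : ℝ} {m : ℕ}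
    {P : Measure Ω} {D : Ω → Fin m → X} {Θhat : Ω → G.Param} {what : Ω → W}
    (hrun : G.IsRun π lam h F Θ₀ η P D Θhat what) : ∀ᵐ ω ∂P, Θhat ω ∈ F := by
  classical
  have hg : ∀ Θ : G.Param, 0 ≤ Fᶜ.indicator (fun _ => (1 : ℝ)) Θ := fun Θ =>
    Set.indicator_nonneg (fun _ _ => zero_le_one) Θ
  obtain ⟨hint, heq⟩ := hrun.integral_comp hlam hspec hg
    (measurable_const.indicator hFc.measurableSet.compl)
  have hle := passMean_le_of_le hFc hF Θstar η (g := Fᶜ.indicator fun _ => (1 : ℝ)) (B := 0)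
    (fun Θ hΘ => by simp [hΘ]) m hΘ₀
  have h0 := (integral_eq_zero_iff_of_nonneg (fun ω => hg (Θhat ω)) hint).1
    (le_antisymm (heq.trans_le hle) (integral_nonneg fun ω => hg _))
  filter_upwards [h0] with ω hω
  by_contra hmem
  simp [hmem] at hω

end WIS

/-! ### Elementary bounds for means and for excesses over an infimum. -/

theorem integral_le_sqrt_integral_sq {Ω : Type*} [MeasurableSpace Ω] {P : Measure Ω}
    [IsProbabilityMeasure P] {f : Ω → ℝ} (hf : Integrable f P)
    (hf2 : Integrable (fun ω => f ω ^ 2) P) : ∫ ω, f ω ∂P ≤ √(∫ ω, f ω ^ 2 ∂P) := by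
  refine Real.le_sqrt_of_sq_le ?_
  set a := ∫ ω, f ω ∂P with ha
  -- Nonnegativity of the variance.
  have h : 0 ≤ ∫ ω, (f ω ^ 2 - 2 * a * f ω + a ^ 2) ∂P :=
    integral_nonneg fun ω => by
      have : f ω ^ 2 - 2 * a * f ω + a ^ 2 = (f ω - a) ^ 2 := by ring
      simp only [Pi.zero_apply, this]
      positivity
  have hi : Integrable (fun ω => 2 * a * f ω) P := hf.const_mul _
  have hi2 : Integrable (fun ω => f ω ^ 2 - 2 * a * f ω) P := hf2.sub hi
  rw [integral_add hi2 (integrable_const _), integral_sub hf2 hi, integral_const_mul, ← ha] at h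
  simp only [integral_const, probReal_univ, smul_eq_mul, one_mul] at h
  linarith

theorem abs_sub_iInf_le {W : Type*} {f : W → ℝ} {C : ℝ} (h0 : ∀ w, 0 ≤ f w) (hC : ∀ w, f w ≤ C) (w : W) :
    |f w - ⨅ w, f w| ≤ C := by
  have : Nonempty W := ⟨w⟩
  have hb : BddBelow (Set.range f) := ⟨0, by rintro _ ⟨w, rfl⟩; exact h0 w⟩
  have h1 : ⨅ w, f w ≤ f w := ciInf_le hb w
  have h2 : 0 ≤ ⨅ w, f w := le_ciInf h0
  rw [abs_of_nonneg (sub_nonneg.2 h1)]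
  linarith [hC w]

/-- The error `L` enters twice: once at `w` and once at the infimum. -/
theorem sub_iInf_le_add {W : Type*} {f g : W → ℝ} {L : ℝ} (h0 : ∀ w, 0 ≤ g w) (hL : ∀ w, |g w - f w| ≤ L)
    (w : W) : f w - ⨅ w, f w ≤ (g w - ⨅ w, g w) + 2 * L := by
  have : Nonempty W := ⟨w⟩
  have hb : BddBelow (Set.range g) := ⟨0, by rintro _ ⟨w, rfl⟩; exact h0 w⟩
  have h1 : (⨅ w, g w) - L ≤ ⨅ w, f w := le_ciInf fun w' => by
    have := ciInf_le hb w'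
    have := (abs_le.1 (hL w')).2
    linarith
  have := (abs_le.1 (hL w)).1
  linarith

namespace WIS

variable {k khat n : ℕ} {G : WIS k khat n}

/-! ### The risks of the end model -/

/-- Separates a log-partition term that does not depend on the label. -/
theorem crossEntropy_eq [NeZero k] (v : Fin k → ℝ) (y : Fin k) :
    crossEntropy v y = Real.log (∑ l, Real.exp (v l)) - v y := by
  have h : 0 < ∑ l, Real.exp (v l) :=
    Finset.sum_pos (fun l _ => Real.exp_pos _) Finset.univ_nonempty
  rw [crossEntropy, Real.log_div (Real.exp_pos _).ne' h.ne', Real.log_exp, neg_sub]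

theorem crossEntropy_nonneg [NeZero k] (v : Fin k → ℝ) (y : Fin k) : 0 ≤ crossEntropy v y := by
  rw [crossEntropy_eq, sub_nonneg]
  calc v y = Real.log (Real.exp (v y)) := (Real.log_exp _).symm
    _ ≤ _ := Real.log_le_log (Real.exp_pos _)
      (Finset.single_le_sum (f := fun l => Real.exp (v l)) (fun l _ => (Real.exp_pos _).le)
        (Finset.mem_univ y))

theorem crossEntropy_le [NeZero k] {v : Fin k → ℝ} {H : ℝ} (hv : ∀ y, |v y| ≤ H) (y : Fin k) :
    crossEntropy v y ≤ 2 * H + Real.log k := by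
  have hk : (0 : ℝ) < k := by exact_mod_cast Nat.pos_of_ne_zero (NeZero.ne k)
  have h1 : Real.log (∑ l, Real.exp (v l)) ≤ Real.log k + H := by
    have e : Real.log k + H = Real.log (k * Real.exp H) := by
      rw [Real.log_mul hk.ne' (Real.exp_pos _).ne', Real.log_exp]
    rw [e]
    refine Real.log_le_log
      (Finset.sum_pos (fun l _ => Real.exp_pos _) Finset.univ_nonempty) ?_
    calc ∑ l, Real.exp (v l) ≤ ∑ _l : Fin k, Real.exp H :=
          Finset.sum_le_sum fun l _ => Real.exp_le_exp.2 ((le_abs_self _).trans (hv l))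
      _ = k * Real.exp H := by simp
  rw [crossEntropy_eq]
  linarith [neg_le_of_abs_le (hv y)]

theorem abs_crossEntropy_le [NeZero k] {v : Fin k → ℝ} {H : ℝ} (hv : ∀ y, |v y| ≤ H)
    (y : Fin k) : |crossEntropy v y| ≤ 2 * H + Real.log k := by
  rw [abs_of_nonneg (crossEntropy_nonneg v y)]
  exact crossEntropy_le hv y

theorem posterior_le_one [NeZero k] (Θ : G.Param) (o : G.Out) (y : Fin k) :
    G.posterior Θ o y ≤ 1 := by
  rw [← G.sum_posterior Θ o]
  exact Finset.single_le_sum (f := fun y => G.posterior Θ o y)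
    (fun y _ => G.posterior_nonneg Θ o y) (Finset.mem_univ y)

variable {X W : Type*} [MeasurableSpace X]

variable (G) in
/-- The part of the risk of the label `y` that comes from the data points with outputs `o`. -/
def partialRisk (π : Measure (X × Fin k))
    (lam : (j : Fin n) → X → {i : Fin khat // i ∈ G.space j}) (h : W → X → Fin k → ℝ)
    (o : G.Out) (y : Fin k) (w : W) : ℝ :=
  ∫ p in {p | G.outputs lam p.1 = o}, crossEntropy (h w p.1) y ∂π

variable {π : Measure (X × Fin k)} {lam : (j : Fin n) → X → {i : Fin khat // i ∈ G.space j}}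
  {h : W → X → Fin k → ℝ} {H : ℝ}

theorem noisyRisk_nonneg [NeZero k] (Θ : G.Param) (w : W) : 0 ≤ G.noisyRisk π lam h Θ w :=
  integral_nonneg fun _ => Finset.sum_nonneg fun _ _ =>
    mul_nonneg (G.posterior_nonneg _ _ _) (crossEntropy_nonneg _ _)

theorem risk_nonneg [NeZero k] (w : W) : 0 ≤ risk π h w :=
  integral_nonneg fun _ => crossEntropy_nonneg _ _

variable [IsProbabilityMeasure π]

theorem noisyRisk_le [NeZero k] (hbound : ∀ w x y, |h w x y| ≤ H) (Θ : G.Param) (w : W) :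
    G.noisyRisk π lam h Θ w ≤ 2 * H + Real.log k := by
  have hle : ∀ p : X × Fin k, ‖G.noisyLoss lam h Θ w p.1‖ ≤ 2 * H + Real.log k := by
    intro p
    rw [Real.norm_eq_abs, noisyLoss, abs_of_nonneg (Finset.sum_nonneg fun _ _ =>
      mul_nonneg (G.posterior_nonneg _ _ _) (crossEntropy_nonneg _ _))]
    calc _ ≤ ∑ y, G.posterior Θ (G.outputs lam p.1) y * (2 * H + Real.log k) :=
          Finset.sum_le_sum fun y _ => mul_le_mul_of_nonneg_left
            (crossEntropy_le (hbound w p.1) y) (G.posterior_nonneg _ _ _)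
      _ = _ := by rw [← Finset.sum_mul, G.sum_posterior, one_mul]
  have := norm_integral_le_of_norm_le_const (μ := π) (Filter.Eventually.of_forall hle)
  rw [probReal_univ, mul_one] at this
  exact (le_abs_self _).trans this

theorem risk_le [NeZero k] (hbound : ∀ w x y, |h w x y| ≤ H) (w : W) :
    risk π h w ≤ 2 * H + Real.log k := by
  have := norm_integral_le_of_norm_le_const (μ := π)
    (f := fun p : X × Fin k => crossEntropy (h w p.1) p.2) (Filter.Eventually.of_forall fun p =>
    abs_crossEntropy_le (hbound w p.1) p.2)
  rw [probReal_univ, mul_one] at this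
  exact (le_abs_self _).trans this

variable [MeasurableSpace W]

theorem measurable_crossEntropy {h : W → X → Fin k → ℝ}
    (hh : ∀ y, Measurable fun p : W × X => h p.1 p.2 y) (y : Fin k) :
    Measurable fun p : W × X => crossEntropy (h p.1 p.2) y := by
  unfold crossEntropy
  have h1 : ∀ l, Measurable fun p : W × X => Real.exp (h p.1 p.2 l) := fun l => (hh l).exp
  exact (Real.measurable_log.comp
    ((h1 y).div (Finset.measurable_fun_sum _ fun l _ => h1 l))).neg

theorem measurableSet_outputs (hlam : ∀ j i, MeasurableSet (lam j ⁻¹' {i})) (o : G.Out) :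
    MeasurableSet {p : X × Fin k | G.outputs lam p.1 = o} :=
  ((measurable_outputs hlam).comp measurable_fst) (measurableSet_singleton o)

theorem integrable_crossEntropy [NeZero k] (hh : ∀ y, Measurable fun p : W × X => h p.1 p.2 y)
    (hbound : ∀ w x y, |h w x y| ≤ H) (w : W) (y : Fin k) :
    Integrable (fun p : X × Fin k => crossEntropy (h w p.1) y) π :=
  Integrable.of_bound (((measurable_crossEntropy hh y).comp
    (measurable_const.prodMk measurable_fst) :
      Measurable fun p : X × Fin k => crossEntropy (h w p.1) y)).aestronglyMeasurable
    (2 * H + Real.log k) (Filter.Eventually.of_forall fun p => abs_crossEntropy_le (hbound w p.1) y)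

theorem measurable_partialRisk (hh : ∀ y, Measurable fun p : W × X => h p.1 p.2 y)
    (o : G.Out) (y : Fin k) : Measurable (G.partialRisk π lam h o y) := by
  have hm : Measurable fun q : W × (X × Fin k) => crossEntropy (h q.1 q.2.1) y :=
    (measurable_crossEntropy hh y).comp
      (measurable_fst.prodMk (measurable_fst.comp measurable_snd))
  exact (StronglyMeasurable.integral_prod_right
    (f := fun w (p : X × Fin k) => crossEntropy (h w p.1) y)
    (ν := π.restrict {p | G.outputs lam p.1 = o}) hm.stronglyMeasurable).measurable

/-- Splits the integral by the finitely many outputs. The coefficient `a` will be the posterior for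
the noise-aware risk and the indicator of the true label for the risk. -/
theorem sum_partialRisk [NeZero k] (hlam : ∀ j i, MeasurableSet (lam j ⁻¹' {i}))
    (hh : ∀ y, Measurable fun p : W × X => h p.1 p.2 y) (hbound : ∀ w x y, |h w x y| ≤ H)
    (a : G.Out → Fin k → X × Fin k → ℝ) (ha : ∀ o y, Measurable (a o y))
    (ha1 : ∀ o y p, ‖a o y p‖ ≤ 1) (w : W) :
    ∫ p, ∑ y, a (G.outputs lam p.1) y p * crossEntropy (h w p.1) y ∂π =
      ∑ o, ∑ y, ∫ p in {p | G.outputs lam p.1 = o}, a o y p * crossEntropy (h w p.1) y ∂π := by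
  have hint : ∀ o y, Integrable (fun p : X × Fin k => a o y p * crossEntropy (h w p.1) y) π :=
    fun o y => (integrable_crossEntropy hh hbound w y).bdd_mul
      (ha o y).aestronglyMeasurable (Filter.Eventually.of_forall (ha1 o y))
  have e : ∀ p : X × Fin k, ∑ y, a (G.outputs lam p.1) y p * crossEntropy (h w p.1) y =
      ∑ o, ∑ y, ({p : X × Fin k | G.outputs lam p.1 = o}).indicator
        (fun p => a o y p * crossEntropy (h w p.1) y) p := by
    intro p
    rw [Finset.sum_eq_single (G.outputs lam p.1)]
    · simp
    · intro o _ ho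
      exact Finset.sum_eq_zero fun y _ => Set.indicator_of_notMem (fun h => ho h.symm) _
    · simp
  simp only [e]
  have hi : ∀ o y, Integrable (({p : X × Fin k | G.outputs lam p.1 = o}).indicator
      (fun p => a o y p * crossEntropy (h w p.1) y)) π := fun o y =>
    (hint o y).indicator (measurableSet_outputs hlam o)
  rw [integral_finsetSum _ fun o _ => integrable_finsetSum _ fun y _ => hi o y]
  refine Finset.sum_congr rfl fun o _ => ?_
  rw [integral_finsetSum _ fun y _ => hi o y]
  exact Finset.sum_congr rfl fun y _ => integral_indicator (measurableSet_outputs hlam o)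

theorem noisyRisk_eq [NeZero k] (hlam : ∀ j i, MeasurableSet (lam j ⁻¹' {i}))
    (hh : ∀ y, Measurable fun p : W × X => h p.1 p.2 y) (hbound : ∀ w x y, |h w x y| ≤ H)
    (Θ : G.Param) (w : W) :
    G.noisyRisk π lam h Θ w = ∑ o, ∑ y, G.posterior Θ o y * G.partialRisk π lam h o y w := by
  have e := sum_partialRisk (π := π) hlam hh hbound (fun o y _ => G.posterior Θ o y)
    (fun _ _ => measurable_const) (fun o y _ => by
      rw [Real.norm_eq_abs, abs_of_nonneg (G.posterior_nonneg _ _ _)]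
      exact posterior_le_one _ _ _) w
  simp only [integral_const_mul] at e
  exact e

/-- Given the outputs, label and data point are independent, so the integral of indicator times
cross entropy factors. Well-specification identifies the label factor with the posterior at `Θstar`.
-/
theorem risk_eq [NeZero k] (hlam : ∀ j i, MeasurableSet (lam j ⁻¹' {i}))
    (hh : ∀ y, Measurable fun p : W × X => h p.1 p.2 y) (hbound : ∀ w x y, |h w x y| ≤ H)
    {Θstar : G.Param} (hspec : G.WellSpecified π lam Θstar) (hindep : G.LabelCondIndep π lam)
    (w : W) :
    risk π h w = ∑ o, ∑ y, G.posterior Θstar o y * G.partialRisk π lam h o y w := by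
  have hind : ∀ y : Fin k, Measurable fun z : Fin k => if z = y then (1 : ℝ) else 0 :=
    fun y => measurable_of_countable _
  have e := sum_partialRisk (π := π) hlam hh hbound
    (fun _ y p => if p.2 = y then (1 : ℝ) else 0) (fun _ y => (hind y).comp measurable_snd)
    (fun _ y p => by split_ifs <;> simp) w
  have e0 : ∀ p : X × Fin k, ∑ y, (if p.2 = y then (1 : ℝ) else 0) * crossEntropy (h w p.1) y =
      crossEntropy (h w p.1) p.2 := fun p => by simp
  simp only [e0] at e
  rw [risk, e]
  refine Finset.sum_congr rfl fun o _ => Finset.sum_congr rfl fun y _ => ?_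
  set A := {p : X × Fin k | G.outputs lam p.1 = o} with hA
  have hAm : MeasurableSet A := measurableSet_outputs hlam o
  have hp : π.real A = G.outProb Θstar o := measureReal_outputs_eq hlam hspec o
  have hpos := G.outProb_pos Θstar o
  have hcond : ∀ f : X × Fin k → ℝ,
      ∫ p, f p ∂(ProbabilityTheory.cond π A) = (G.outProb Θstar o)⁻¹ * ∫ p in A, f p ∂π := by
    intro f
    rw [ProbabilityTheory.cond, integral_smul_measure, smul_eq_mul, ENNReal.toReal_inv]
    congr 2
  have hce : Measurable fun x : X => crossEntropy (h w x) y :=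
    (measurable_crossEntropy hh y).comp (measurable_const.prodMk measurable_id)
  have hi := (hindep o).comp (hind y) hce
  have hmul := hi.integral_mul_eq_mul_integral
    ((hind y).comp measurable_snd).aestronglyMeasurable
    (hce.comp measurable_fst).aestronglyMeasurable
  have hlab : ∫ p in A, (if p.2 = y then (1 : ℝ) else 0) ∂π = G.labelOutProb Θstar y o := by
    rw [← hspec y o]
    have hy : MeasurableSet {p : X × Fin k | p.2 = y} :=
      measurable_snd (measurableSet_singleton y)
    have e1 : (fun p : X × Fin k => if p.2 = y then (1 : ℝ) else 0) =
        ({p : X × Fin k | p.2 = y}).indicator 1 := by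
      funext p
      simp [Set.indicator_apply]
    rw [e1, integral_indicator_one hy, measureReal_restrict_apply hy]
    rfl
  simp only [Pi.mul_apply, Function.comp_apply] at hmul
  rw [← hA] at hmul
  rw [hcond, hcond, hcond, hlab, ← outProb_mul_posterior] at hmul
  rw [partialRisk]
  field_simp at hmul
  linarith

/-- The noise-aware risk is close to the risk when the parameter is close to the true one. -/
theorem abs_noisyRisk_sub_risk_le [NeZero k] (hlam : ∀ j i, MeasurableSet (lam j ⁻¹' {i}))
    (hh : ∀ y, Measurable fun p : W × X => h p.1 p.2 y) (hbound : ∀ w x y, |h w x y| ≤ H)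
    (hH : 0 ≤ H) {F : Set G.Param} (hF : Convex ℝ F) {Θstar Θ : G.Param} {c : ℝ}
    (hspec : G.WellSpecified π lam Θstar) (hindep : G.LabelCondIndep π lam)
    (hvar : G.LowPosteriorVariance F Θstar c) (hΘstar : Θstar ∈ F) (hΘ : Θ ∈ F) (w : W) :
    |G.noisyRisk π lam h Θ w - risk π h w| ≤
      H * (2 * c / √G.numFactors * ‖Θ - Θstar‖) := by
  set δ : G.Out → Fin k → ℝ := fun o y => G.posterior Θ o y - G.posterior Θstar o y with hδ
  set b : G.Out → Fin k → ℝ := fun o y =>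
    ∫ p in {p : X × Fin k | G.outputs lam p.1 = o}, h w p.1 y ∂π with hb
  set q : G.Out → ℝ := fun o =>
    ∫ p in {p : X × Fin k | G.outputs lam p.1 = o}, Real.log (∑ l, Real.exp (h w p.1 l)) ∂π
    with hq
  have hhint : ∀ y, Integrable (fun p : X × Fin k => h w p.1 y) π := fun y =>
    Integrable.of_bound (((hh y).comp (measurable_const.prodMk measurable_fst) :
      Measurable fun p : X × Fin k => h w p.1 y)).aestronglyMeasurable H
      (Filter.Eventually.of_forall fun p => hbound w p.1 y)
  have hR : ∀ o y, G.partialRisk π lam h o y w = q o - b o y := by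
    intro o y
    have hl : Integrable (fun p : X × Fin k => Real.log (∑ l, Real.exp (h w p.1 l))) π := by
      refine ((integrable_crossEntropy hh hbound w y).add (hhint y)).congr
        (Filter.Eventually.of_forall fun p => ?_)
      simp [crossEntropy_eq]
    simp only [partialRisk, crossEntropy_eq, hq, hb]
    exact integral_sub hl.integrableOn (hhint y).integrableOn
  -- Both posteriors have total mass one, so the log-partition part `q` drops out. This is why the
  -- bound involves `H` and not `log k`.
  have hδ0 : ∀ o, ∑ y, δ o y = 0 := fun o => by
    simp only [hδ, Finset.sum_sub_distrib, sum_posterior, sub_self]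
  have hbb : ∀ o y, |b o y| ≤ H * G.outProb Θstar o := by
    intro o y
    rw [← measureReal_outputs_eq hlam hspec o]
    exact norm_setIntegral_le_of_norm_le_const (f := fun p : X × Fin k => h w p.1 y)
      (measure_lt_top π _) fun p _ => hbound w p.1 y
  have e : G.noisyRisk π lam h Θ w - risk π h w = -∑ o, ∑ y, δ o y * b o y := by
    rw [noisyRisk_eq hlam hh hbound, risk_eq hlam hh hbound hspec hindep,
      ← Finset.sum_sub_distrib, ← Finset.sum_neg_distrib]
    refine Finset.sum_congr rfl fun o _ => ?_
    rw [← Finset.sum_sub_distrib]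
    have e1 : ∀ y, G.posterior Θ o y * G.partialRisk π lam h o y w -
        G.posterior Θstar o y * G.partialRisk π lam h o y w = δ o y * q o - δ o y * b o y := by
      intro y
      rw [hR]
      simp only [hδ]
      ring
    simp only [e1, Finset.sum_sub_distrib, ← Finset.sum_mul, hδ0]
    ring
  rw [e, abs_neg]
  have hsign : ∀ x : ℝ, (if 0 ≤ x then (1 : ℝ) else -1) * x = |x| := by
    intro x
    split_ifs with hx
    · rw [abs_of_nonneg hx, one_mul]
    · rw [abs_of_neg (not_le.1 hx), neg_one_mul]
  -- The sign of `δ` as test function turns the Lipschitz estimate into an `ℓ¹` bound.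
  have hL := sum_outProb_mul_posterior_sub_le hF hvar hΘstar hΘ
    (a := fun o y => if 0 ≤ δ o y then (1 : ℝ) else -1) (fun o y => by split_ifs <;> simp)
  calc |∑ o, ∑ y, δ o y * b o y| ≤ ∑ o, ∑ y, |δ o y| * (H * G.outProb Θstar o) := by
        refine (Finset.abs_sum_le_sum_abs _ _).trans (Finset.sum_le_sum fun o _ => ?_)
        refine (Finset.abs_sum_le_sum_abs _ _).trans (Finset.sum_le_sum fun y _ => ?_)
        rw [abs_mul]
        exact mul_le_mul_of_nonneg_left (hbb o y) (abs_nonneg _)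
    _ = H * ∑ o, G.outProb Θstar o * ∑ y, |δ o y| := by
        simp only [Finset.mul_sum]
        exact Finset.sum_congr rfl fun _ _ => Finset.sum_congr rfl fun _ _ => by ring
    _ ≤ _ := by
        refine mul_le_mul_of_nonneg_left ?_ hH
        refine le_trans (le_of_eq ?_) hL
        refine Finset.sum_congr rfl fun o _ => ?_
        congr 1
        exact Finset.sum_congr rfl fun y _ => (hsign _).symm

theorem continuous_posterior [NeZero k] (o : G.Out) (y : Fin k) :
    Continuous fun Θ : G.Param => G.posterior Θ o y := by
  have hw : ∀ s : G.State, Continuous fun Θ : G.Param => G.weight Θ s := fun s => by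
    unfold weight
    fun_prop
  unfold posterior
  refine continuous_finsetSum _ fun s _ => ?_
  unfold condProb
  split_ifs
  · refine (hw s).div (continuous_finsetSum _ fun s' _ => ?_)
      fun Θ => (G.sum_weight_out_pos Θ o).ne'
    split_ifs
    · exact hw s'
    · exact continuous_const
  · exact continuous_const
  · exact continuous_const

/-- The infimum may range over uncountably many `w`; as an infimum of functions continuous in `Θ` it
is upper semicontinuous. -/
theorem measurable_iInf_noisyRisk [NeZero k] (hlam : ∀ j i, MeasurableSet (lam j ⁻¹' {i}))
    (hh : ∀ y, Measurable fun p : W × X => h p.1 p.2 y) (hbound : ∀ w x y, |h w x y| ≤ H) :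
    Measurable fun Θ : G.Param => ⨅ w, G.noisyRisk π lam h Θ w := by
  refine UpperSemicontinuous.measurable (upperSemicontinuous_ciInf (fun Θ => ?_) fun w => ?_)
  · exact ⟨0, by rintro _ ⟨w, rfl⟩; exact noisyRisk_nonneg Θ w⟩
  · refine Continuous.upperSemicontinuous ?_
    simp only [noisyRisk_eq hlam hh hbound]
    exact continuous_finsetSum _ fun o _ => continuous_finsetSum _ fun y _ =>
      (continuous_posterior o y).mul continuous_const

end WIS

namespace WIS

variable {k khat n : ℕ} {G : WIS k khat n}

/-! ### Generalization of the learned end model -/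

variable {X W Ω : Type*} [MeasurableSpace X] [MeasurableSpace W] [MeasurableSpace Ω]

theorem IsRun.integrable_risk_sub [NeZero k] {π : Measure (X × Fin k)} [IsProbabilityMeasure π]
    {lam : (j : Fin n) → X → {i : Fin khat // i ∈ G.space j}}
    (hlam : ∀ j i, MeasurableSet (lam j ⁻¹' {i}))
    {h : W → X → Fin k → ℝ} (hh : ∀ y, Measurable fun p : W × X => h p.1 p.2 y)
    {H : ℝ} (hbound : ∀ w x y, |h w x y| ≤ H) {F : Set G.Param} {Θstar Θ₀ : G.Param}
    (hspec : G.WellSpecified π lam Θstar) (hindep : G.LabelCondIndep π lam) {η : ℝ} {m : ℕ}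
    {P : Measure Ω} [IsProbabilityMeasure P] {D : Ω → Fin m → X} {Θhat : Ω → G.Param}
    {what : Ω → W} (hrun : G.IsRun π lam h F Θ₀ η P D Θhat what) :
    Integrable (fun ω => risk π h (what ω) - ⨅ w, risk π h w) P := by
  have hm : Measurable (risk π h) := by
    have e : risk π h = fun w => ∑ o, ∑ y, G.posterior Θstar o y * G.partialRisk π lam h o y w :=
      funext fun w => risk_eq hlam hh hbound hspec hindep w
    rw [e]
    exact Finset.measurable_fun_sum _ fun o _ => Finset.measurable_fun_sum _ fun y _ =>
      (measurable_partialRisk hh o y).const_mul _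
  exact Integrable.of_bound
    ((hm.comp hrun.measurable_what).sub measurable_const).aestronglyMeasurable
    (2 * H + Real.log k) (Filter.Eventually.of_forall fun ω =>
      abs_sub_iInf_le risk_nonneg (risk_le hbound) (what ω))

theorem IsRun.integrable_noisyRisk_sub [NeZero k] {π : Measure (X × Fin k)}
    [IsProbabilityMeasure π] {lam : (j : Fin n) → X → {i : Fin khat // i ∈ G.space j}}
    (hlam : ∀ j i, MeasurableSet (lam j ⁻¹' {i}))
    {h : W → X → Fin k → ℝ} (hh : ∀ y, Measurable fun p : W × X => h p.1 p.2 y)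
    {H : ℝ} (hbound : ∀ w x y, |h w x y| ≤ H) {F : Set G.Param} {Θ₀ : G.Param} {η : ℝ} {m : ℕ}
    {P : Measure Ω} [IsProbabilityMeasure P] {D : Ω → Fin m → X} {Θhat : Ω → G.Param}
    {what : Ω → W} (hrun : G.IsRun π lam h F Θ₀ η P D Θhat what) :
    Integrable (fun ω => G.noisyRisk π lam h (Θhat ω) (what ω) -
      ⨅ w, G.noisyRisk π lam h (Θhat ω) w) P := by
  have hm : Measurable fun ω => G.noisyRisk π lam h (Θhat ω) (what ω) := by
    simp only [noisyRisk_eq hlam hh hbound]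
    exact Finset.measurable_fun_sum _ fun o _ => Finset.measurable_fun_sum _ fun y _ =>
      ((continuous_posterior o y).measurable.comp hrun.measurable_Θhat).mul
        ((measurable_partialRisk hh o y).comp hrun.measurable_what)
  exact Integrable.of_bound (hm.sub
    ((measurable_iInf_noisyRisk hlam hh hbound).comp hrun.measurable_Θhat)).aestronglyMeasurable
    (2 * H + Real.log k) (Filter.Eventually.of_forall fun ω =>
      abs_sub_iInf_le (noisyRisk_nonneg _) (noisyRisk_le hbound _) (what ω))

/-- Accurate parameters give an accurate end model. -/
theorem IsRun.integral_risk_sub_le [NeZero k] {π : Measure (X × Fin k)} [IsProbabilityMeasure π]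
    {lam : (j : Fin n) → X → {i : Fin khat // i ∈ G.space j}}
    (hlam : ∀ j i, MeasurableSet (lam j ⁻¹' {i}))
    {h : W → X → Fin k → ℝ} (hh : ∀ y, Measurable fun p : W × X => h p.1 p.2 y)
    {H : ℝ} (hbound : ∀ w x y, |h w x y| ≤ H) (hH : 0 ≤ H) {F : Set G.Param} (hFc : IsClosed F)
    (hF : Convex ℝ F) {Θstar Θ₀ : G.Param} (hΘstar : Θstar ∈ F) (hΘ₀ : Θ₀ ∈ F) {c χ : ℝ}
    (hc : 0 < c) (hspec : G.WellSpecified π lam Θstar) (hindep : G.LabelCondIndep π lam)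
    (hvar : G.LowPosteriorVariance F Θstar c) {η : ℝ} {m : ℕ}
    {P : Measure Ω} [IsProbabilityMeasure P] {D : Ω → Fin m → X} {Θhat : Ω → G.Param}
    {what : Ω → W} (hrun : G.IsRun π lam h F Θ₀ η P D Θhat what)
    (hgen : ∫ ω, (G.noisyRisk π lam h (Θhat ω) (what ω)
      - ⨅ w, G.noisyRisk π lam h (Θhat ω) w) ∂P ≤ χ) {ε : ℝ} (hε : 0 ≤ ε)
    (hdist : ∫ ω, ‖Θhat ω - Θstar‖ ^ 2 ∂P ≤ G.numFactors * ε ^ 2) :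
    ∫ ω, (risk π h (what ω) - ⨅ w, risk π h w) ∂P ≤ χ + 4 * c * H * ε := by
  have hi1 := hrun.integrable_risk_sub hlam hh hbound hspec hindep
  have hi2 := hrun.integrable_noisyRisk_sub hlam hh hbound
  obtain ⟨hd, -⟩ := hrun.integral_comp hlam hspec (g := fun Θ => ‖Θ - Θstar‖)
    (fun Θ => norm_nonneg _) (by fun_prop)
  obtain ⟨hd2, -⟩ := hrun.integral_comp hlam hspec (g := fun Θ => ‖Θ - Θstar‖ ^ 2)
    (fun Θ => by positivity) (by fun_prop)
  have hpt : ∀ᵐ ω ∂P, risk π h (what ω) - ⨅ w, risk π h w ≤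
      (G.noisyRisk π lam h (Θhat ω) (what ω) - ⨅ w, G.noisyRisk π lam h (Θhat ω) w) +
        4 * c * H / √G.numFactors * ‖Θhat ω - Θstar‖ := by
    filter_upwards [hrun.ae_mem hlam hFc hF hΘ₀ hspec] with ω hω
    refine (sub_iInf_le_add (noisyRisk_nonneg (Θhat ω)) (fun w => abs_noisyRisk_sub_risk_le
      hlam hh hbound hH hF hspec hindep hvar hΘstar hω w) (what ω)).trans_eq ?_
    ring
  have hmean : ∫ ω, ‖Θhat ω - Θstar‖ ∂P ≤ √G.numFactors * ε := by
    refine (integral_le_sqrt_integral_sq hd hd2).trans ((Real.sqrt_le_sqrt hdist).trans_eq ?_)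
    rw [Real.sqrt_mul (by positivity), Real.sqrt_sq hε]
  calc _ ≤ ∫ ω, ((G.noisyRisk π lam h (Θhat ω) (what ω) - ⨅ w, G.noisyRisk π lam h (Θhat ω) w) +
        4 * c * H / √G.numFactors * ‖Θhat ω - Θstar‖) ∂P :=
        integral_mono_ae hi1 (hi2.add (hd.const_mul _)) hpt
    _ = ∫ ω, (G.noisyRisk π lam h (Θhat ω) (what ω) - ⨅ w, G.noisyRisk π lam h (Θhat ω) w) ∂P +
        4 * c * H / √G.numFactors * ∫ ω, ‖Θhat ω - Θstar‖ ∂P := by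
        rw [integral_add hi2 (hd.const_mul _), integral_const_mul]
    _ ≤ χ + 4 * c * H / √G.numFactors * (√G.numFactors * ε) := by gcongr
    _ ≤ χ + 4 * c * H * ε := by
        rw [add_le_add_iff_left]
        -- If `M = 0` the roots cannot be cancelled, but the product is zero.
        rcases (Real.sqrt_nonneg (G.numFactors : ℝ)).eq_or_lt with h0 | h0
        · rw [← h0, zero_mul, mul_zero]
          positivity
        · refine le_of_eq ?_
          field_simp

/-! ### Convergence of the learned parameter -/

/-- The error after one pass: the initial error decays exponentially, and the noise of the
gradients contributes an error proportional to the step size. -/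
theorem passMean_dist_sq_le_exp [NeZero k] {F : Set G.Param} (hFc : IsClosed F)
    (hF : Convex ℝ F) {Θstar Θ : G.Param} {c : ℝ} {m : ℕ} (hc : 0 < c) (hm : 0 < m)
    (heff : G.EfficientEstimator F c m) (hvar : G.LowPosteriorVariance F Θstar c)
    (hΘstar : Θstar ∈ F) (hΘ : Θ ∈ F) {η : ℝ} (hη : 0 ≤ η) (hη1 : 2 * η * c ≤ 1) :
    G.passMean Θstar F η (fun Θ' => ‖Θ' - Θstar‖ ^ 2) m Θ ≤
      Real.exp (-(2 * η * c * m)) * ‖Θ - Θstar‖ ^ 2 + η * G.numFactors / (2 * c) := by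
  refine (passMean_dist_sq_le hFc hF hc hm heff hvar hΘstar hΘ hη hη1 m).trans ?_
  have h0 : 0 ≤ 1 - 2 * η * c := by linarith
  have h1 : (1 - 2 * η * c) ^ m ≤ Real.exp (-(2 * η * c * m)) := by
    calc _ ≤ Real.exp (-(2 * η * c)) ^ m :=
          pow_le_pow_left₀ h0 (Real.one_sub_le_exp_neg _) m
      _ = _ := by
          rw [← Real.exp_nat_mul]
          congr 1
          ring
  have h2 : 0 ≤ η * G.numFactors / (2 * c) := by positivity
  have h3 : η * G.numFactors / (2 * c) * (1 - (1 - 2 * η * c) ^ m) ≤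
      η * G.numFactors / (2 * c) :=
    mul_le_of_le_one_right h2 (by linarith [pow_nonneg h0 m])
  have h4 := mul_le_mul_of_nonneg_right h1 (sq_nonneg ‖Θ - Θstar‖)
  linarith

/-- The step size makes the noise term `M ε² / 8`, and the sample size brings the initial error down
to `ε² / 2`. -/
theorem passMean_dist_sq_le_of_accuracy [NeZero k] {F : Set G.Param} (hFc : IsClosed F)
    (hF : Convex ℝ F) {Θstar Θ : G.Param} {c : ℝ} {m : ℕ} (hc : 0 < c) (hm : 0 < m)
    (heff : G.EfficientEstimator F c m) (hvar : G.LowPosteriorVariance F Θstar c)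
    (hΘstar : Θstar ∈ F) (hΘ : Θ ∈ F) {ε : ℝ} (hε : 0 < ε)
    (hm' : (m : ℝ) > 2 / (c ^ 2 * ε ^ 2) * Real.log (2 * ‖Θ - Θstar‖ ^ 2 / ε ^ 2)) :
    G.passMean Θstar F (c * ε ^ 2 / 4) (fun Θ' => ‖Θ' - Θstar‖ ^ 2) m Θ ≤
      G.numFactors * ε ^ 2 := by
  have hbdd : ∀ Θ ∈ F, ‖Θ - Θstar‖ ^ 2 ≤ G.numFactors / c ^ 2 := fun Θ h =>
    dist_sq_le_of_mem hF hc hm heff hvar hΘstar h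
  rcases le_or_gt (2 * (c * ε ^ 2 / 4) * c) 1 with hη | hη
  · have h := passMean_dist_sq_le_exp hFc hF hc hm heff hvar hΘstar hΘ
      (by positivity : 0 ≤ c * ε ^ 2 / 4) hη
    have e : c * ε ^ 2 / 4 * G.numFactors / (2 * c) = G.numFactors * ε ^ 2 / 8 := by
      field_simp
      ring
    rw [e] at h
    have hMε : 0 ≤ (G.numFactors : ℝ) * ε ^ 2 := by positivity
    rcases (sq_nonneg ‖Θ - Θstar‖).eq_or_lt with h0 | h0
    · rw [← h0] at h
      linarith
    · have hM : (1 : ℝ) ≤ G.numFactors := by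
        have : (0 : ℝ) < G.numFactors := by
          have := h0.trans_le (hbdd Θ hΘ)
          exact (div_pos_iff_of_pos_right (by positivity)).1 this
        exact_mod_cast this
      have hlog : Real.log (2 * ‖Θ - Θstar‖ ^ 2 / ε ^ 2) ≤ 2 * (c * ε ^ 2 / 4) * c * m := by
        calc _ = c ^ 2 * ε ^ 2 / 2 *
              (2 / (c ^ 2 * ε ^ 2) * Real.log (2 * ‖Θ - Θstar‖ ^ 2 / ε ^ 2)) := by field_simp
          _ ≤ c ^ 2 * ε ^ 2 / 2 * m := by gcongr
          _ = _ := by ring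
      have hexp : Real.exp (-(2 * (c * ε ^ 2 / 4) * c * m)) * ‖Θ - Θstar‖ ^ 2 ≤ ε ^ 2 / 2 := by
        calc _ ≤ Real.exp (-Real.log (2 * ‖Θ - Θstar‖ ^ 2 / ε ^ 2)) * ‖Θ - Θstar‖ ^ 2 := by
              gcongr
          _ = ε ^ 2 / 2 := by
              have hn := h0.ne'
              rw [Real.exp_neg, Real.exp_log (by positivity)]
              generalize ‖Θ - Θstar‖ ^ 2 = d at hn
              field_simp
      nlinarith [sq_nonneg ε]
  -- Here `c² ε² > 2`, so the bound `M / c²` valid on all of `F` is already below `M ε²`.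
  · refine passMean_le_of_le hFc hF Θstar _ (fun Θ' hΘ' => (hbdd Θ' hΘ').trans ?_) m hΘ
    rw [div_le_iff₀ (by positivity), mul_assoc]
    exact le_mul_of_one_le_right (by positivity) (by nlinarith)

/-- The initial error decays by `exp (-2 log m) = m⁻²`, at most `log m / m` because `1/m ≤ 1/2 ≤ log
m`. It multiplies the bound `M / c²`, and the noise adds half of `(M / c²) (log m / m)`. -/
theorem passMean_dist_sq_le_of_rate [NeZero k] {F : Set G.Param} (hFc : IsClosed F)
    (hF : Convex ℝ F) {Θstar Θ : G.Param} {c : ℝ} {m : ℕ} (hc : 0 < c) (hm : 2 ≤ m)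
    (heff : G.EfficientEstimator F c m) (hvar : G.LowPosteriorVariance F Θstar c)
    (hΘstar : Θstar ∈ F) (hΘ : Θ ∈ F) :
    G.passMean Θstar F (Real.log m / (c * m)) (fun Θ' => ‖Θ' - Θstar‖ ^ 2) m Θ ≤
      4 / c ^ 2 * (G.numFactors * (Real.log m / m)) := by
  have hm0 : 0 < m := by omega
  have hm2 : (2 : ℝ) ≤ m := by exact_mod_cast hm
  have hmp : (0 : ℝ) < m := by linarith
  have hlog : 1 / 2 ≤ Real.log m := by
    have h1 := Real.log_two_gt_d9
    have h2 := Real.log_le_log (by norm_num) hm2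
    linarith
  have hbdd : ∀ Θ ∈ F, ‖Θ - Θstar‖ ^ 2 ≤ G.numFactors / c ^ 2 := fun Θ h =>
    dist_sq_le_of_mem hF hc hm0 heff hvar hΘstar h
  have hηc : 2 * (Real.log m / (c * m)) * c = 2 * (Real.log m / m) := by field_simp
  set q : ℝ := G.numFactors / c ^ 2 with hq
  have hq0 : 0 ≤ q := by positivity
  have hgoal : 4 / c ^ 2 * (G.numFactors * (Real.log m / m)) = 4 * (Real.log m / m) * q := by
    rw [hq]
    ring
  rw [hgoal]
  rcases le_or_gt (2 * (Real.log m / (c * m)) * c) 1 with hη | hη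
  · have h := passMean_dist_sq_le_exp hFc hF hc hm0 heff hvar hΘstar hΘ
      (by positivity : 0 ≤ Real.log m / (c * m)) hη
    have e : Real.log m / (c * m) * G.numFactors / (2 * c) = 1 / 2 * (Real.log m / m) * q := by
      rw [hq]
      field_simp
    have hexp : Real.exp (-(2 * (Real.log m / (c * m)) * c * m)) ≤ Real.log m / m := by
      have e1 : -(2 * (Real.log m / (c * m)) * c * m) = -Real.log m + -Real.log m := by
        field_simp
        ring
      rw [e1, Real.exp_add, Real.exp_neg, Real.exp_log hmp, div_eq_mul_inv]
      have hinv : (m : ℝ)⁻¹ ≤ 1 / 2 := by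
        rw [← one_div]
        exact one_div_le_one_div_of_le (by norm_num) hm2
      gcongr
      linarith
    have h2 := mul_le_mul hexp (hbdd Θ hΘ) (sq_nonneg _) (by positivity)
    rw [e] at h
    have h3 : 0 ≤ Real.log m / m * q := by positivity
    linarith
  -- Here `log m / m > 1/2`, so the bound on `F` suffices.
  · refine passMean_le_of_le hFc hF Θstar _ (fun Θ' hΘ' => (hbdd Θ' hΘ').trans ?_) m hΘ
    exact le_mul_of_one_le_left hq0 (by linarith)

end WIS

end

/-! ### The main theorem. -/

theorem theorem1 {k khat n : ℕ} [NeZero k] (G : WIS k khat n)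
    {X W Ω : Type*} [MeasurableSpace X] [MeasurableSpace W] [MeasurableSpace Ω]
    -- problem distribution, labeling functions, logits of the end model
    (π : Measure (X × Fin k)) [IsProbabilityMeasure π]
    (lam : (j : Fin n) → X → {i : Fin khat // i ∈ G.space j})
    (hlam : ∀ j i, MeasurableSet (lam j ⁻¹' {i}))
    (h : W → X → Fin k → ℝ) (hh : ∀ y, Measurable fun p : W × X => h p.1 p.2 y)
    -- feasible set, true and initial parameters
    (F : Set G.Param) (hFclosed : IsClosed F) (hFconvex : Convex ℝ F)
    (Θstar Θ₀ : G.Param) (hΘstar : Θstar ∈ F) (hΘ₀ : Θ₀ ∈ F)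
    (c H χ : ℝ) (hc : 0 < c) (m : ℕ) (hm : 0 < m)
    -- assumptions on the model and on the end model
    (hspec : G.WellSpecified π lam Θstar)
    (hindep : G.LabelCondIndep π lam)
    (heff : G.EfficientEstimator F c m)
    (hvar : G.LowPosteriorVariance F Θstar c)
    (hbound : ∀ w x y, |h w x y| ≤ H)
    -- a run of the algorithm with step size `η` on a dataset of size `m`
    (P : Measure Ω) [IsProbabilityMeasure P] (η : ℝ)
    (D : Ω → Fin m → X) (Θhat : Ω → G.Param) (what : Ω → W)
    (hrun : G.IsRun π lam h F Θ₀ η P D Θhat what)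
    (hgen : ∫ ω, (G.noisyRisk π lam h (Θhat ω) (what ω)
      - ⨅ w, G.noisyRisk π lam h (Θhat ω) w) ∂P ≤ χ) :
    Integrable (fun ω => ‖Θhat ω - Θstar‖ ^ 2) P ∧
    Integrable (fun ω => WIS.risk π h (what ω) - ⨅ w, WIS.risk π h w) P ∧
    -- accuracy `ε` from a large enough dataset
    (∀ ε : ℝ, 0 < ε → η = c * ε ^ 2 / 4 →
      (m : ℝ) > 2 / (c ^ 2 * ε ^ 2) * Real.log (2 * ‖Θ₀ - Θstar‖ ^ 2 / ε ^ 2) →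
      ∫ ω, ‖Θhat ω - Θstar‖ ^ 2 ∂P ≤ G.numFactors * ε ^ 2 ∧
      ∫ ω, (WIS.risk π h (what ω) - ⨅ w, WIS.risk π h w) ∂P ≤ χ + 4 * c * H * ε) ∧
    -- the rates in terms of the size of the dataset
    (2 ≤ m → η = Real.log m / (c * m) →
      ∫ ω, ‖Θhat ω - Θstar‖ ^ 2 ∂P ≤ 4 / c ^ 2 * (G.numFactors * (Real.log m / m)) ∧
      ∫ ω, (WIS.risk π h (what ω) - ⨅ w, WIS.risk π h w) ∂P ≤
        χ + 8 * (H * Real.sqrt (Real.log m / m))) := by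
  have hH : 0 ≤ H := by
    obtain ⟨ω⟩ := nonempty_of_isProbabilityMeasure P
    obtain ⟨p⟩ := nonempty_of_isProbabilityMeasure π
    exact (abs_nonneg _).trans (hbound (what ω) p.1 0)
  obtain ⟨hint, hmean⟩ := hrun.integral_comp hlam hspec (g := fun Θ => ‖Θ - Θstar‖ ^ 2)
    (fun Θ => by positivity) (by fun_prop)
  have hrisk : ∀ ε : ℝ, 0 ≤ ε → ∫ ω, ‖Θhat ω - Θstar‖ ^ 2 ∂P ≤ G.numFactors * ε ^ 2 →
      ∫ ω, (WIS.risk π h (what ω) - ⨅ w, WIS.risk π h w) ∂P ≤ χ + 4 * c * H * ε :=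
    fun ε hε hd => hrun.integral_risk_sub_le hlam hh hbound hH hFclosed hFconvex hΘstar hΘ₀ hc
      hspec hindep hvar hgen hε hd
  refine ⟨hint, hrun.integrable_risk_sub hlam hh hbound hspec hindep, fun ε hε hη hlarge => ?_,
    fun hm2 hη => ?_⟩
  · subst hη
    have hd := hmean.trans_le (WIS.passMean_dist_sq_le_of_accuracy hFclosed hFconvex hc hm heff
      hvar hΘstar hΘ₀ hε hlarge)
    exact ⟨hd, hrisk ε hε.le hd⟩
  · subst hη
    have hd := hmean.trans_le (WIS.passMean_dist_sq_le_of_rate hFclosed hFconvex hc hm2 heff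
      hvar hΘstar hΘ₀)
    have hrate : 0 ≤ Real.log m / m := by positivity
    -- This `ε` makes `M ε²` equal to the parameter bound just obtained, and `4cHε` then equals `8H
    -- √(log m / m)`.
    refine ⟨hd, (hrisk (2 / c * √(Real.log m / m)) (by positivity) (hd.trans_eq ?_)).trans_eq ?_⟩
    · rw [mul_pow, Real.sq_sqrt hrate]
      ring
    · field_simp
      ring
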